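/- **Setting.** Consider the linear quantum $\lambda$-calculus with types $A,B ::= \mathtt{bit}\mid\mathtt{qbit}\mid 1\mid A\multimap B\mid A\otimes B$, with terms $M,N,P ::= x\mid\lambda x.M\mid M\,N\mid *\mid \mathtt{let}\ *=M\ \mathtt{in}\ N\mid (M,N)\mid \mathtt{let}\ (x,y)=M\ \mathtt{in}\ N\mid \mathtt{if}\ M\ \mathtt{then}\ N\ \mathtt{else}\ P\mid c$ ($c$ one of the operators $\mathtt{zero},\mathtt{one},\mathtt{discard},\mathtt{new},\mathtt{meas},H,S,T,\mathrm{CNOT}$, with its type $\mathcal T(c)$ = tensor of the input types $\multimap$ tensor of the output types), and with the usual linear typing judgments $\Gamma\vdash M:A$, where in $\mathtt{if}$ the guard has type $\mathtt{bit}$ in a context $\Delta$ and both branches have the same type $A$ in the same context $\Gamma$, disjoint from $\Delta$. **Synchronization graph.** The *synchronization points* of a derivation $\pi$ are: each atomic axiom $\mathbb A\vdash\mathbb A$ of an identity axiom $x:A\vdash x:A$ (one for each occurrence of an atom $\mathbb A\in\{\mathtt{bit},\mathtt{qbit},1\}$ in $A$); each axiom $\vdash c:\mathcal T(c)$; each if-then-else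 rule. They are indexed by elements of a set $I$; $\pi$ is *well-indexed* if distinct synchronization points have distinct indices. A *position* of $\pi$ is an occurrence of an atom in a judgment of $\pi$; in $\Gamma\vdash M:A$ polarities are as usual in $A$ and reversed in $\Gamma$. The positions in the conclusion of a synchronization point are all positions of that axiom, or, for an if-then-else rule with conclusion $\Delta,\Gamma\vdash \mathtt{if}\ M\ \mathtt{then}\ N\ \mathtt{else}\ P:A$, those in $\Gamma$ and $A$. A *simple path* is a finite sequence of structural moves of a token: from a negative position in the conclusion of a rule up to the same occurrence in a premise, from a positive position in a premise down to the same occurrence in the conclusion, and, in the rules for application and for $\mathtt{let}\ (x,y)$, from a positive position of the type $A$ (resp. $A\otimes B$) shared by the two premises to the corresponding position in the other premise; an if-then-else rule allows moves only between the context $\Delta$ of the conclusion and that of the guard. The *synchronization graph* $\mathscr G_\pi$ has as nodes the indices of the synchronization points and an edge $i\to j$ whenever there is a simple path from a positive position in the conclusion of a point of index $i$ to a negative position in the conclusion of a point of index $j$. **Colored types.** In a *colored type* each occurrence of an atom carries at most one color from $I$; $|A|$ forgets the colors of $A$ and $|A|^i$ gives the color $i$ to all atoms of $A$. If $|A|=|A'|$,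 let $\mathscr M_{A,A'}$ be the set of the edges $i\to j$ such that, at some position of $|A|$, either the position is negative in $A$ and has color $i$ in $A$ and $j$ in $A'$, or it is positive in $A$ and has color $i$ in $A'$ and $j$ in $A$. The colored judgments $\Gamma\vdash^{\mathscr G}M:A$ are derived by the following rules ($\Delta,\Gamma$ disjoint; a set of indices stands for the graph with these nodes and no edge). - $x:A\vdash^{\{i_1,\dots,i_n\}}x:A$, where the atoms of $A$ have the colors $i_1,\dots,i_n$; $\ \vdash^{\{i\}}c:|\mathcal T(c)|^i$; $\ \vdash^{\emptyset}*:1$ (no color). - From $\Gamma,x:A\vdash^{\mathscr G}M:B$ infer $\Gamma\vdash^{\mathscr G}\lambda x.M:A\multimap B$. - From $\Delta\vdash^{\mathscr G_1}M:A\multimap B$ and $\Gamma\vdash^{\mathscr G_2}N:A'$ with $|A|=|A'|$ infer $\Delta,\Gamma\vdash^{\mathscr G_1\cup\mathscr G_2\cup\mathscr M_{A,A'}}M\,N:B$. - From $\Delta\vdash^{\mathscr G_1}M:1$ (any color) and $\Gamma\vdash^{\mathscr G_2}N:A$ infer $\Delta,\Gamma\vdash^{\mathscr G_1\cup\mathscr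 G_2}\mathtt{let}\ *=M\ \mathtt{in}\ N:A$. - From $\Delta\vdash^{\mathscr G_1}M:A$ and $\Gamma\vdash^{\mathscr G_2}N:B$ infer $\Delta,\Gamma\vdash^{\mathscr G_1\cup\mathscr G_2}(M,N):A\otimes B$. - From $\Delta\vdash^{\mathscr G_1}M:A'\otimes B'$ and $\Gamma,x:A,y:B\vdash^{\mathscr G_2}N:C$ with $|A|=|A'|$, $|B|=|B'|$ infer $\Delta,\Gamma\vdash^{\mathscr G_1\cup\mathscr G_2\cup\mathscr M_{A\otimes B,A'\otimes B'}}\mathtt{let}\ (x,y)=M\ \mathtt{in}\ N:C$. - From $\Delta\vdash^{\mathscr G_1}M:\mathtt{bit}$ (any color), $\Gamma\vdash^{\mathscr G_2}N:A$ and $\Gamma'\vdash^{\mathscr G_3}P:A'$ with $|\Gamma|=|\Gamma'|$, $|A|=|A'|$ infer $\Delta,|\Gamma|^i\vdash^{\mathscr G_1\cup\mathscr G_2\cup\mathscr G_3\cup\{i\}}\mathtt{if}\ M\ \mathtt{then}\ N\ \mathtt{else}\ P:|A|^i$. Forgetting the colors and the graphs in a colored derivation $\pi$ gives an indexed derivation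 $|\pi|$. **Theorem.** The colored type system computes exactly the synchronization graph: 1. for every colored derivation $\pi$ of $\Gamma\vdash^{\mathscr G}M:A$ one has $\mathscr G=\mathscr G_{|\pi|}$; 2. every indexed derivation is $|\pi|$ for some colored derivation $\pi$. Consequently, $\Gamma\vdash M:A$ has a well-indexed derivation with acyclic synchronization graph if and only if there is a colored derivation $\pi$ of some $\Gamma'\vdash^{\mathscr G}M:A'$ with $|\Gamma'|=\Gamma$, $|A'|=A$, $|\pi|$ well-indexed and $\mathscr G$ acyclic. -/

import Mathlib

/-! A linear quantum lambda-calculus, the synchronization graph of its typing derivations,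
and the colored type system. -/

namespace QLam

universe u v

/-! ### Types, occurrences of atoms and their polarity -/

/-- Variables. -/
abbrev Var := ℕ

/-- Atomic types: the base types `bit`, `qbit`, and the unit type `1`. -/
inductive Atom
  | bit
  | qbit
  | one

/-- Types `A, B ::= bit | qbit | 1 | A ⊸ B | A ⊗ B`, in which every occurrence of an atom carries
a label from `L`. -/
inductive LTy (L : Type u) : Type u
  | atom (a : Atom) (l : L)
  | lolli (A B : LTy L)
  | tensor (A B : LTy L)

/-- Plain types: the labels carry no information. -/
abbrev Ty := LTy Unit

/-- Colored types: an occurrence of an atom carries a color from `I`, or no color (which happens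
only for units produced by a unit axiom). -/
abbrev CTy (I : Type u) := LTy (Option I)

/-- Relabelling. -/
def LTy.map {L : Type u} {L' : Type v} (f : L → L') : LTy L → LTy L'
  | .atom a l => .atom a (f l)
  | .lolli A B => .lolli (A.map f) (B.map f)
  | .tensor A B => .tensor (A.map f) (B.map f)

/-- `|A|`: forget all labels. -/
def LTy.erase {L : Type u} (A : LTy L) : Ty := A.map fun _ => ()

/-- `|A|^i`: give the color `i` to all atoms of `A`. -/
def LTy.paint {L : Type u} {I : Type v} (i : I) (A : LTy L) : CTy I := A.map fun _ => some i

/-- The list of labels of the atoms of a type, from left to right. -/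
def LTy.labels {L : Type u} : LTy L → List L
  | .atom _ l => [l]
  | .lolli A B => A.labels ++ B.labels
  | .tensor A B => A.labels ++ B.labels

/-- One step from a compound type to one of its two immediate components. -/
inductive Dir
  | left
  | right

/-- A path from the root of a type to one of its subformulas. -/
abbrev Path := List Dir

/-- Polarities. -/
inductive Pol
  | pos
  | neg

/-- The opposite polarity. -/
def Pol.flip : Pol → Pol
  | .pos => .neg
  | .neg => .pos

/-- The polarity of the occurrence of an atom at the end of a path
(`none` if no atom occurs there). -/
def LTy.polAt {L : Type u} : LTy L → Path → Option Pol
  | .atom _ _, [] => some .pos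
  | .lolli A _, .left :: p => (A.polAt p).map Pol.flip
  | .lolli _ B, .right :: p => B.polAt p
  | .tensor A _, .left :: p => A.polAt p
  | .tensor _ B, .right :: p => B.polAt p
  | _, _ => none

/-- The label of the occurrence of an atom at the end of a path
(`none` if no atom occurs there). -/
def LTy.labelAt {L : Type u} : LTy L → Path → Option L
  | .atom _ l, [] => some l
  | .lolli A _, .left :: p => A.labelAt p
  | .lolli _ B, .right :: p => B.labelAt p
  | .tensor A _, .left :: p => A.labelAt p
  | .tensor _ B, .right :: p => B.labelAt p
  | _, _ => none

/-! ### Operators and terms -/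

/-- The quantum operators. -/
inductive Op
  | zero
  | one
  | discard
  | new
  | meas
  | H
  | S
  | T
  | CNOT

/-- Input types of an operator. -/
def Op.inputs : Op → List Atom
  | .zero => []
  | .one => []
  | .discard => [.bit]
  | .new => [.bit]
  | .meas => [.qbit]
  | .H => [.qbit]
  | .S => [.qbit]
  | .T => [.qbit]
  | .CNOT => [.qbit, .qbit]

/-- Output types of an operator. -/
def Op.outputs : Op → List Atom
  | .zero => [.bit]
  | .one => [.bit]
  | .discard => []
  | .new => [.qbit]
  | .meas => [.bit]
  | .H => [.qbit]
  | .S => [.qbit]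
  | .T => [.qbit]
  | .CNOT => [.qbit, .qbit]

/-- The tensor of a sequence of atoms; the empty tensor is `1`. -/
def tensorAll : List Atom → Ty
  | [] => .atom .one ()
  | [a] => .atom a ()
  | a :: b :: as => .tensor (.atom a ()) (tensorAll (b :: as))

/-- The type of an operator. -/
def Op.type (c : Op) : Ty := .lolli (tensorAll c.inputs) (tensorAll c.outputs)

/-- Terms. `letStar M N` is `let * = M in N`, and `letPair x y M N` is `let (x, y) = M in N`. -/
inductive Tm
  | var (x : Var)
  | lam (x : Var) (M : Tm)
  | app (M N : Tm)
  | star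
  | letStar (M N : Tm)
  | pair (M N : Tm)
  | letPair (x y : Var) (M N : Tm)
  | ite (M N P : Tm)
  | op (c : Op)

/-! ### Typing contexts -/

/-- Typing contexts: each variable has at most one type. (Contexts of derivable judgments are
finite: they declare exactly the free variables of the term.) -/
abbrev LCtx (L : Type u) := Var → Option (LTy L)

/-- Plain contexts. -/
abbrev Ctx := LCtx Unit

/-- Colored contexts. -/
abbrev CCtx (I : Type u) := LCtx (Option I)

/-- The context with no declaration. -/
def LCtx.empty {L : Type u} : LCtx L := fun _ => none

/-- `Γ, x : A` (used only when `x` is not declared in `Γ`). -/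
def LCtx.extend {L : Type u} (Γ : LCtx L) (x : Var) (A : LTy L) : LCtx L :=
  Function.update Γ x (some A)

/-- The context `x : A`. -/
def LCtx.single {L : Type u} (x : Var) (A : LTy L) : LCtx L := LCtx.empty.extend x A

/-- `Θ` is the context `Δ, Γ`, the union of two contexts that declare no common variable. -/
def LCtx.Split {L : Type u} (Θ Δ Γ : LCtx L) : Prop :=
  ∀ x, (Γ x = none ∧ Θ x = Δ x) ∨ (Δ x = none ∧ Θ x = Γ x)

/-- Relabelling of a context. -/
def LCtx.map {L : Type u} {L' : Type v} (f : L → L') (Γ : LCtx L) : LCtx L' :=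
  fun x => (Γ x).map (LTy.map f)

/-- `|Γ|`: forget all labels. -/
def LCtx.erase {L : Type u} (Γ : LCtx L) : Ctx := Γ.map fun _ => ()

/-- `|Γ|^i`: give the color `i` to all atoms of `Γ`. -/
def LCtx.paint {L : Type u} {I : Type v} (i : I) (Γ : LCtx L) : CCtx I := Γ.map fun _ => some i

/-! ### Indexed typing derivations -/

/-- Derivations `π` of the linear typing judgments `Γ ⊢ M : A`, whose synchronization points are
indexed by elements of `I`. The synchronization points are
* every atomic axiom `𝔸 ⊢ 𝔸` that an identity axiom `x : A ⊢ x : A` consists of, one for each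
  occurrence of an atom in `A`; the indices are given as a labelling `ι` of `A`;
* every axiom `⊢ c : T(c)` for an operator `c`;
* every if-then-else rule.

Forgetting `ι` and the two arguments `i`, the rules are exactly the typing rules. -/
inductive Deriv (I : Type u) : Ctx → Tm → Ty → Type u
  | ax {Γ : Ctx} {A : Ty} (x : Var) (ι : LTy I) (hA : ι.erase = A) (hΓ : Γ = LCtx.single x A) :
      Deriv I Γ (.var x) A
  | lam {Γ Γ' : Ctx} {M : Tm} {A B : Ty} (x : Var) (hx : Γ x = none) (hΓ : Γ' = Γ.extend x A)
      (d : Deriv I Γ' M B) : Deriv I Γ (.lam x M) (.lolli A B)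
  | app {Θ Δ Γ : Ctx} {M N : Tm} {A B : Ty} (hΘ : LCtx.Split Θ Δ Γ)
      (d₁ : Deriv I Δ M (.lolli A B)) (d₂ : Deriv I Γ N A) : Deriv I Θ (.app M N) B
  | star {Γ : Ctx} (hΓ : Γ = LCtx.empty) : Deriv I Γ .star (.atom .one ())
  | letStar {Θ Δ Γ : Ctx} {M N : Tm} {A : Ty} (hΘ : LCtx.Split Θ Δ Γ)
      (d₁ : Deriv I Δ M (.atom .one ())) (d₂ : Deriv I Γ N A) : Deriv I Θ (.letStar M N) A
  | pair {Θ Δ Γ : Ctx} {M N : Tm} {A B : Ty} (hΘ : LCtx.Split Θ Δ Γ)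
      (d₁ : Deriv I Δ M A) (d₂ : Deriv I Γ N B) : Deriv I Θ (.pair M N) (.tensor A B)
  | letPair {Θ Δ Γ Γ' : Ctx} {M N : Tm} {A B C : Ty} (x y : Var) (hΘ : LCtx.Split Θ Δ Γ)
      (hx : Γ x = none) (hy : Γ y = none) (hxy : x ≠ y) (hΓ : Γ' = (Γ.extend x A).extend y B)
      (d₁ : Deriv I Δ M (.tensor A B)) (d₂ : Deriv I Γ' N C) : Deriv I Θ (.letPair x y M N) C
  | ite {Θ Δ Γ : Ctx} {M N P : Tm} {A : Ty} (i : I) (hΘ : LCtx.Split Θ Δ Γ)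
      (d₁ : Deriv I Δ M (.atom .bit ())) (d₂ : Deriv I Γ N A) (d₃ : Deriv I Γ P A) :
      Deriv I Θ (.ite M N P) A
  | op {Γ : Ctx} {A : Ty} (i : I) (c : Op) (hA : A = c.type) (hΓ : Γ = LCtx.empty) :
      Deriv I Γ (.op c) A

/-- The indices of all synchronization points of a derivation, with repetitions. -/
def Deriv.indices {I : Type u} : {Γ : Ctx} → {M : Tm} → {A : Ty} → Deriv I Γ M A → List I
  | _, _, _, .ax _ ι _ _ => ι.labels
  | _, _, _, .lam _ _ _ d => d.indices
  | _, _, _, .app _ d₁ d₂ => d₁.indices ++ d₂.indices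
  | _, _, _, .star _ => []
  | _, _, _, .letStar _ d₁ d₂ => d₁.indices ++ d₂.indices
  | _, _, _, .pair _ d₁ d₂ => d₁.indices ++ d₂.indices
  | _, _, _, .letPair _ _ _ _ _ _ _ d₁ d₂ => d₁.indices ++ d₂.indices
  | _, _, _, .ite i _ d₁ d₂ d₃ => i :: (d₁.indices ++ d₂.indices ++ d₃.indices)
  | _, _, _, .op i _ _ _ => [i]

/-- Distinct synchronization points have distinct indices. -/
def Deriv.WellIndexed {I : Type u} {Γ : Ctx} {M : Tm} {A : Ty} (d : Deriv I Γ M A) : Prop :=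
  d.indices.Nodup

/-! ### Positions and simple paths -/

/-- A position of a derivation: an occurrence of an atom in one of its judgments.
`addr` is the path from the root of the derivation to the judgment (`k` leads to the conclusion of
the derivation of the premise number `k`, counting from `0`); `loc` is `none` for the type of the
term and `some x` for the type of the variable `x` in the context; `path` leads to the atom inside
that type. -/
structure Pos where
  addr : List ℕ
  loc : Option Var
  path : Path

/-- A position of the derivation of the premise number `k`, as a position of the whole. -/
def Pos.under (k : ℕ) (σ : Pos) : Pos := ⟨k :: σ.addr, σ.loc, σ.path⟩

/-- A relation on positions of the premise number `k`, as a relation on positions of the whole. -/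
def liftRel (k : ℕ) (R : Pos → Pos → Prop) (σ τ : Pos) : Prop :=
  ∃ σ' τ', R σ' τ' ∧ σ = σ'.under k ∧ τ = τ'.under k

/-- A set of positions of the premise number `k`, as a set of positions of the whole. -/
def liftPred (k : ℕ) (R : Pos → Prop) (σ : Pos) : Prop := ∃ σ', R σ' ∧ σ = σ'.under k

/-- The polarity of an occurrence in a judgment `Γ ⊢ M : A`: as in `A` on the right-hand side,
reversed on the left-hand side. -/
def seqPol (Γ : Ctx) (A : Ty) : Option Var → Path → Option Pol
  | none, p => A.polAt p
  | some x, p => ((Γ x).bind fun B => B.polAt p).map Pol.flip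

/-- The polarity of a position of a derivation (`none` if there is no such position). -/
def Deriv.polAt {I : Type u} :
    {Γ : Ctx} → {M : Tm} → {A : Ty} → Deriv I Γ M A → List ℕ → Option Var → Path → Option Pol
  | Γ, _, A, _, [], l, p => seqPol Γ A l p
  | _, _, _, .lam _ _ _ d, 0 :: a, l, p => d.polAt a l p
  | _, _, _, .app _ d₁ _, 0 :: a, l, p => d₁.polAt a l p
  | _, _, _, .app _ _ d₂, 1 :: a, l, p => d₂.polAt a l p
  | _, _, _, .letStar _ d₁ _, 0 :: a, l, p => d₁.polAt a l p
  | _, _, _, .letStar _ _ d₂, 1 :: a, l, p => d₂.polAt a l p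
  | _, _, _, .pair _ d₁ _, 0 :: a, l, p => d₁.polAt a l p
  | _, _, _, .pair _ _ d₂, 1 :: a, l, p => d₂.polAt a l p
  | _, _, _, .letPair _ _ _ _ _ _ _ d₁ _, 0 :: a, l, p => d₁.polAt a l p
  | _, _, _, .letPair _ _ _ _ _ _ _ _ d₂, 1 :: a, l, p => d₂.polAt a l p
  | _, _, _, .ite _ _ d₁ _ _, 0 :: a, l, p => d₁.polAt a l p
  | _, _, _, .ite _ _ _ d₂ _, 1 :: a, l, p => d₂.polAt a l p
  | _, _, _, .ite _ _ _ _ d₃, 2 :: a, l, p => d₃.polAt a l p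
  | _, _, _, _, _, _, _ => none

/-- The polarity of a position of a derivation (`none` if there is no such position). -/
def Deriv.pol {I : Type u} {Γ : Ctx} {M : Tm} {A : Ty} (d : Deriv I Γ M A) (σ : Pos) :
    Option Pol := d.polAt σ.addr σ.loc σ.path

/-- The conclusion declares the variables of `Γ`, and so does the premise number `k`. -/
inductive CtxWire (Γ : Ctx) (k : ℕ) : Pos → Pos → Prop
  | mk (y : Var) (p : Path) (hy : Γ y ≠ none) : CtxWire Γ k ⟨[], some y, p⟩ ⟨[k], some y, p⟩

/-- In the abstraction rule, `A ⊸ B` in the conclusion consists of the type `A` of `x` and the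
type `B` of the body. -/
inductive LamWire (x : Var) : Pos → Pos → Prop
  | arg (p : Path) : LamWire x ⟨[], none, .left :: p⟩ ⟨[0], some x, p⟩
  | res (p : Path) : LamWire x ⟨[], none, .right :: p⟩ ⟨[0], none, p⟩

/-- In the application rule, the type of the conclusion is the right part of `A ⊸ B`. -/
inductive AppWire : Pos → Pos → Prop
  | res (p : Path) : AppWire ⟨[], none, p⟩ ⟨[0], none, .right :: p⟩

/-- In the pair rule, `A ⊗ B` in the conclusion consists of the types of the two premises. -/
inductive PairWire : Pos → Pos → Prop
  | fst (p : Path) : PairWire ⟨[], none, .left :: p⟩ ⟨[0], none, p⟩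
  | snd (p : Path) : PairWire ⟨[], none, .right :: p⟩ ⟨[1], none, p⟩

/-- In both let rules, the type of the conclusion is the type of the second premise. -/
inductive LetWire : Pos → Pos → Prop
  | res (p : Path) : LetWire ⟨[], none, p⟩ ⟨[1], none, p⟩

/-- `d.Vert σ τ`: the position `σ` in the conclusion of some rule of `d` and the position `τ` in a
premise of that rule are the same occurrence of an atom. In an if-then-else rule this relates only
the context of the guard, as the rest of the conclusion belongs to the synchronization point. -/
def Deriv.Vert {I : Type u} :
    {Γ : Ctx} → {M : Tm} → {A : Ty} → Deriv I Γ M A → Pos → Pos → Prop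
  | Γ, _, _, .lam x _ _ d, σ, τ => CtxWire Γ 0 σ τ ∨ LamWire x σ τ ∨ liftRel 0 d.Vert σ τ
  | _, _, _, .app (Δ := Δ) (Γ := Γ) _ d₁ d₂, σ, τ =>
      CtxWire Δ 0 σ τ ∨ CtxWire Γ 1 σ τ ∨ AppWire σ τ ∨
        liftRel 0 d₁.Vert σ τ ∨ liftRel 1 d₂.Vert σ τ
  | _, _, _, .letStar (Δ := Δ) (Γ := Γ) _ d₁ d₂, σ, τ =>
      CtxWire Δ 0 σ τ ∨ CtxWire Γ 1 σ τ ∨ LetWire σ τ ∨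
        liftRel 0 d₁.Vert σ τ ∨ liftRel 1 d₂.Vert σ τ
  | _, _, _, .pair (Δ := Δ) (Γ := Γ) _ d₁ d₂, σ, τ =>
      CtxWire Δ 0 σ τ ∨ CtxWire Γ 1 σ τ ∨ PairWire σ τ ∨
        liftRel 0 d₁.Vert σ τ ∨ liftRel 1 d₂.Vert σ τ
  | _, _, _, .letPair (Δ := Δ) (Γ := Γ) _ _ _ _ _ _ _ d₁ d₂, σ, τ =>
      CtxWire Δ 0 σ τ ∨ CtxWire Γ 1 σ τ ∨ LetWire σ τ ∨
        liftRel 0 d₁.Vert σ τ ∨ liftRel 1 d₂.Vert σ τ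
  | _, _, _, .ite (Δ := Δ) _ _ d₁ d₂ d₃, σ, τ =>
      CtxWire Δ 0 σ τ ∨
        liftRel 0 d₁.Vert σ τ ∨ liftRel 1 d₂.Vert σ τ ∨ liftRel 2 d₃.Vert σ τ
  | _, _, _, .ax _ _ _ _, _, _ => False
  | _, _, _, .star _, _, _ => False
  | _, _, _, .op _ _ _ _, _, _ => False

/-- In the application rule, the left part of the type `A ⊸ B` of the function is linked with the
type `A` of the argument. -/
inductive AppCut : Pos → Pos → Prop
  | mk (p : Path) : AppCut ⟨[0], none, .left :: p⟩ ⟨[1], none, p⟩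

/-- In the rule for `let (x, y) = M in N`, the two parts of the type `A ⊗ B` of `M` are linked with
the types of `x` and `y`. -/
inductive LetPairCut (x y : Var) : Pos → Pos → Prop
  | fst (p : Path) : LetPairCut x y ⟨[0], none, .left :: p⟩ ⟨[1], some x, p⟩
  | snd (p : Path) : LetPairCut x y ⟨[0], none, .right :: p⟩ ⟨[1], some y, p⟩

/-- `d.Cut σ τ`: the positions `σ` and `τ`, which lie in two premises of the same rule of `d`, are
linked by that rule. -/
def Deriv.Cut {I : Type u} :
    {Γ : Ctx} → {M : Tm} → {A : Ty} → Deriv I Γ M A → Pos → Pos → Prop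
  | _, _, _, .lam _ _ _ d, σ, τ => liftRel 0 d.Cut σ τ
  | _, _, _, .app _ d₁ d₂, σ, τ => AppCut σ τ ∨ liftRel 0 d₁.Cut σ τ ∨ liftRel 1 d₂.Cut σ τ
  | _, _, _, .letStar _ d₁ d₂, σ, τ => liftRel 0 d₁.Cut σ τ ∨ liftRel 1 d₂.Cut σ τ
  | _, _, _, .pair _ d₁ d₂, σ, τ => liftRel 0 d₁.Cut σ τ ∨ liftRel 1 d₂.Cut σ τ
  | _, _, _, .letPair x y _ _ _ _ _ d₁ d₂, σ, τ =>
      LetPairCut x y σ τ ∨ liftRel 0 d₁.Cut σ τ ∨ liftRel 1 d₂.Cut σ τ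
  | _, _, _, .ite _ _ d₁ d₂ d₃, σ, τ =>
      liftRel 0 d₁.Cut σ τ ∨ liftRel 1 d₂.Cut σ τ ∨ liftRel 2 d₃.Cut σ τ
  | _, _, _, .ax _ _ _ _, _, _ => False
  | _, _, _, .star _, _, _ => False
  | _, _, _, .op _ _ _ _, _, _ => False

/-- The structural moves of a token: it goes up along negative positions, down along positive
positions, and crosses the links between premises starting from a positive position. -/
inductive Deriv.Move {I : Type u} {Γ : Ctx} {M : Tm} {A : Ty} (d : Deriv I Γ M A) :
    Pos → Pos → Prop
  | up {σ τ : Pos} : d.Vert σ τ → d.pol σ = some .neg → d.Move σ τ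
  | down {σ τ : Pos} : d.Vert σ τ → d.pol τ = some .pos → d.Move τ σ
  | cross {σ τ : Pos} : d.Cut σ τ → d.pol σ = some .pos → d.Move σ τ
  | crossBack {σ τ : Pos} : d.Cut σ τ → d.pol τ = some .pos → d.Move τ σ

/-- There is a simple path from `σ` to `τ`: a finite sequence of structural moves (so it does not
go through a synchronization point). -/
def Deriv.SimplePath {I : Type u} {Γ : Ctx} {M : Tm} {A : Ty} (d : Deriv I Γ M A) :
    Pos → Pos → Prop := Relation.ReflTransGen d.Move

/-- `d.InSync i σ`: the position `σ` belongs to the conclusion of a synchronization point of `d` of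
index `i`. For an if-then-else rule with conclusion `Δ, Γ ⊢ if M then N else P : A`, where `Δ` is
the context of the guard `M`, these are the positions in `Γ` and `A`. -/
def Deriv.InSync {I : Type u} :
    {Γ : Ctx} → {M : Tm} → {A : Ty} → Deriv I Γ M A → I → Pos → Prop
  | _, _, _, .ax x ι _ _, i, σ =>
      σ.addr = [] ∧ (σ.loc = none ∨ σ.loc = some x) ∧ ι.labelAt σ.path = some i
  | _, _, _, .lam _ _ _ d, i, σ => liftPred 0 (d.InSync i) σ
  | _, _, _, .app _ d₁ d₂, i, σ => liftPred 0 (d₁.InSync i) σ ∨ liftPred 1 (d₂.InSync i) σ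
  | _, _, _, .star _, _, _ => False
  | _, _, _, .letStar _ d₁ d₂, i, σ => liftPred 0 (d₁.InSync i) σ ∨ liftPred 1 (d₂.InSync i) σ
  | _, _, _, .pair _ d₁ d₂, i, σ => liftPred 0 (d₁.InSync i) σ ∨ liftPred 1 (d₂.InSync i) σ
  | _, _, _, .letPair _ _ _ _ _ _ _ d₁ d₂, i, σ =>
      liftPred 0 (d₁.InSync i) σ ∨ liftPred 1 (d₂.InSync i) σ
  | _, _, _, .ite (Γ := Γ) j _ d₁ d₂ d₃, i, σ =>
      (i = j ∧ σ.addr = [] ∧ (σ.loc = none ∨ ∃ y, σ.loc = some y ∧ Γ y ≠ none)) ∨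
        liftPred 0 (d₁.InSync i) σ ∨ liftPred 1 (d₂.InSync i) σ ∨ liftPred 2 (d₃.InSync i) σ
  | _, _, _, .op j _ _ _, i, σ => i = j ∧ σ.addr = [] ∧ σ.loc = none

/-! ### Graphs and the synchronization graph -/

/-- Directed graphs whose nodes are elements of `I`. -/
@[ext]
structure SGraph (I : Type u) where
  nodes : Set I
  edges : Set (I × I)

/-- The graph with no node. -/
def SGraph.empty {I : Type u} : SGraph I := ⟨∅, ∅⟩

/-- The graph with the given nodes and no edge. -/
def SGraph.discrete {I : Type u} (s : Set I) : SGraph I := ⟨s, ∅⟩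

/-- Union of graphs. -/
def SGraph.union {I : Type u} (G H : SGraph I) : SGraph I :=
  ⟨G.nodes ∪ H.nodes, G.edges ∪ H.edges⟩

/-- Add edges. -/
def SGraph.addEdges {I : Type u} (G : SGraph I) (E : Set (I × I)) : SGraph I :=
  ⟨G.nodes, G.edges ∪ E⟩

/-- No directed cycle (of length at least `1`). -/
def SGraph.Acyclic {I : Type u} (G : SGraph I) : Prop :=
  ∀ i, ¬ Relation.TransGen (fun a b => (a, b) ∈ G.edges) i i

/-- The synchronization graph of a derivation: its nodes are (the indices of) the synchronization
points, with an edge from `i` to `j` if there is a simple path from a positive position in the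
conclusion of `i` to a negative position in the conclusion of `j`. -/
def Deriv.syncGraph {I : Type u} {Γ : Ctx} {M : Tm} {A : Ty} (d : Deriv I Γ M A) : SGraph I where
  nodes := {i | i ∈ d.indices}
  edges := {e | ∃ σ τ, d.InSync e.1 σ ∧ d.pol σ = some .pos ∧
    d.InSync e.2 τ ∧ d.pol τ = some .neg ∧ d.SimplePath σ τ}

/-! ### The colored type system -/

/-- The color of the occurrence of an atom at the end of a path, if it has one. -/
def LTy.colorAt {I : Type u} (A : CTy I) (p : Path) : Option I := (A.labelAt p).join

/-- The edges created when a value of type `A'` is supplied where the type `A` is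
expected, with `|A| = |A'|`: at a positive occurrence an edge from its color in `A'` to its color
in `A`, and at a negative occurrence an edge from its color in `A` to its color in `A'`. -/
def matchEdges {I : Type u} (A A' : CTy I) : Set (I × I) :=
  {e | ∃ p, (A.polAt p = some .pos ∧ A'.colorAt p = some e.1 ∧ A.colorAt p = some e.2) ∨
    (A.polAt p = some .neg ∧ A.colorAt p = some e.1 ∧ A'.colorAt p = some e.2)}

/-- Derivations of the colored judgments `Γ ⊢^G M : A`, where `Γ` and `A` are colored and `G` is a
graph on the colors. The axioms for variables and operators, and the if-then-else rule introduce
the indices of their synchronization points as colors. -/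
inductive CDeriv (I : Type u) : CCtx I → SGraph I → Tm → CTy I → Type u
  | ax {Γ : CCtx I} {A : CTy I} (x : Var) (ι : LTy I) (hA : A = ι.map some)
      (hΓ : Γ = LCtx.single x A) :
      CDeriv I Γ (SGraph.discrete {i | i ∈ ι.labels}) (.var x) A
  | lam {Γ Γ' : CCtx I} {G : SGraph I} {M : Tm} {A B : CTy I} (x : Var) (hx : Γ x = none)
      (hΓ : Γ' = Γ.extend x A) (D : CDeriv I Γ' G M B) : CDeriv I Γ G (.lam x M) (.lolli A B)
  | app {Θ Δ Γ : CCtx I} {G₁ G₂ : SGraph I} {M N : Tm} {A A' B : CTy I}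
      (hΘ : LCtx.Split Θ Δ Γ) (hA : A.erase = A'.erase)
      (D₁ : CDeriv I Δ G₁ M (.lolli A B)) (D₂ : CDeriv I Γ G₂ N A') :
      CDeriv I Θ ((G₁.union G₂).addEdges (matchEdges A A')) (.app M N) B
  | star {Γ : CCtx I} (hΓ : Γ = LCtx.empty) : CDeriv I Γ SGraph.empty .star (.atom .one none)
  | letStar {Θ Δ Γ : CCtx I} {G₁ G₂ : SGraph I} {M N : Tm} {c : Option I} {A : CTy I}
      (hΘ : LCtx.Split Θ Δ Γ) (D₁ : CDeriv I Δ G₁ M (.atom .one c)) (D₂ : CDeriv I Γ G₂ N A) :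
      CDeriv I Θ (G₁.union G₂) (.letStar M N) A
  | pair {Θ Δ Γ : CCtx I} {G₁ G₂ : SGraph I} {M N : Tm} {A B : CTy I} (hΘ : LCtx.Split Θ Δ Γ)
      (D₁ : CDeriv I Δ G₁ M A) (D₂ : CDeriv I Γ G₂ N B) :
      CDeriv I Θ (G₁.union G₂) (.pair M N) (.tensor A B)
  | letPair {Θ Δ Γ Γ' : CCtx I} {G₁ G₂ : SGraph I} {M N : Tm} {A A' B B' C : CTy I} (x y : Var)
      (hΘ : LCtx.Split Θ Δ Γ) (hx : Γ x = none) (hy : Γ y = none) (hxy : x ≠ y)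
      (hΓ : Γ' = (Γ.extend x A).extend y B) (hA : A.erase = A'.erase) (hB : B.erase = B'.erase)
      (D₁ : CDeriv I Δ G₁ M (.tensor A' B')) (D₂ : CDeriv I Γ' G₂ N C) :
      CDeriv I Θ ((G₁.union G₂).addEdges (matchEdges (.tensor A B) (.tensor A' B')))
        (.letPair x y M N) C
  | ite {Θ Δ Γ Γ' Γi : CCtx I} {G₁ G₂ G₃ : SGraph I} {M N P : Tm} {c : Option I}
      {A A' Ai : CTy I} (i : I)
      (hΘ : LCtx.Split Θ Δ Γi) (hΓi : Γi = Γ.paint i) (hAi : Ai = A.paint i)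
      (hΓ : Γ.erase = Γ'.erase) (hA : A.erase = A'.erase)
      (D₁ : CDeriv I Δ G₁ M (.atom .bit c)) (D₂ : CDeriv I Γ G₂ N A) (D₃ : CDeriv I Γ' G₃ P A') :
      CDeriv I Θ (((G₁.union G₂).union G₃).union (SGraph.discrete {i})) (.ite M N P) Ai
  | op {Γ : CCtx I} {A : CTy I} (i : I) (c : Op) (hA : A = c.type.paint i)
      (hΓ : Γ = LCtx.empty) : CDeriv I Γ (SGraph.discrete {i}) (.op c) A

/-! ### Erasing the colors -/

theorem LTy.erase_map {L : Type u} {L' : Type v} (f : L → L') (A : LTy L) :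
    (A.map f).erase = A.erase := by
  induction A with
  | atom a l => rfl
  | lolli A B ihA ihB => simp only [LTy.map, LTy.erase] at *; rw [ihA, ihB]
  | tensor A B ihA ihB => simp only [LTy.map, LTy.erase] at *; rw [ihA, ihB]

theorem LTy.erase_plain (A : Ty) : A.erase = A := by
  induction A with
  | atom a l => rfl
  | lolli A B ihA ihB => simp only [LTy.map, LTy.erase] at *; rw [ihA, ihB]
  | tensor A B ihA ihB => simp only [LTy.map, LTy.erase] at *; rw [ihA, ihB]

theorem LCtx.erase_empty {L : Type u} : (LCtx.empty : LCtx L).erase = LCtx.empty := rfl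

theorem LCtx.erase_extend {L : Type u} (Γ : LCtx L) (x : Var) (A : LTy L) :
    (Γ.extend x A).erase = Γ.erase.extend x A.erase := by
  funext y
  by_cases h : y = x
  · subst h; simp [LCtx.erase, LCtx.map, LCtx.extend, LTy.erase]
  · simp [LCtx.erase, LCtx.map, LCtx.extend, h]

theorem LCtx.erase_single {L : Type u} (x : Var) (A : LTy L) :
    (LCtx.single x A).erase = LCtx.single x A.erase := LCtx.erase_extend _ _ _

theorem LCtx.erase_paint {L : Type u} {I : Type v} (i : I) (Γ : LCtx L) :
    (Γ.paint i).erase = Γ.erase := by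
  funext y
  cases h : Γ y with
  | none => simp [LCtx.erase, LCtx.map, LCtx.paint, h]
  | some A =>
    simpa [LCtx.erase, LCtx.map, LCtx.paint, h, LTy.erase] using
      LTy.erase_map (fun _ => some i) A

theorem LCtx.erase_eq_none {L : Type u} {Γ : LCtx L} {x : Var} (h : Γ x = none) :
    Γ.erase x = none := by simp [LCtx.erase, LCtx.map, h]

theorem LCtx.Split.erase {L : Type u} {Θ Δ Γ : LCtx L} (h : LCtx.Split Θ Δ Γ) :
    LCtx.Split Θ.erase Δ.erase Γ.erase := by
  intro x
  rcases h x with ⟨h₁, h₂⟩ | ⟨h₁, h₂⟩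
  · exact Or.inl ⟨LCtx.erase_eq_none h₁, by simp [LCtx.erase, LCtx.map, h₂]⟩
  · exact Or.inr ⟨LCtx.erase_eq_none h₁, by simp [LCtx.erase, LCtx.map, h₂]⟩

/-- Replace the context and the type in the conclusion of a derivation by equal ones. -/
def Deriv.recast {I : Type u} {Γ Γ' : Ctx} {M : Tm} {A A' : Ty} (hΓ : Γ = Γ') (hA : A = A')
    (d : Deriv I Γ M A) : Deriv I Γ' M A' := hΓ ▸ hA ▸ d

/-- `|π|`: the indexed derivation obtained from a colored derivation by forgetting the colors of
the types and the annotations of the judgments. -/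
def CDeriv.erase {I : Type u} : {Γ : CCtx I} → {G : SGraph I} → {M : Tm} → {A : CTy I} →
    CDeriv I Γ G M A → Deriv I Γ.erase M A.erase
  | _, _, _, _, .ax x ι hA hΓ =>
      .ax x ι (by rw [hA, LTy.erase_map]) (by rw [hΓ, LCtx.erase_single])
  | _, _, _, _, .lam x hx hΓ D =>
      .lam x (LCtx.erase_eq_none hx) (by rw [hΓ, LCtx.erase_extend]; rfl) D.erase
  | _, _, _, _, .app (B := B) hΘ hA D₁ D₂ =>
      .app (B := B.erase) hΘ.erase D₁.erase (D₂.erase.recast rfl hA.symm)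
  | _, _, _, _, .star hΓ => .star (by rw [hΓ, LCtx.erase_empty])
  | _, _, _, _, .letStar hΘ D₁ D₂ => .letStar hΘ.erase D₁.erase D₂.erase
  | _, _, _, _, .pair hΘ D₁ D₂ => .pair hΘ.erase D₁.erase D₂.erase
  | _, _, _, _, .letPair (A' := A') (B' := B') x y hΘ hx hy hxy hΓ hA hB D₁ D₂ =>
      .letPair (A := A'.erase) (B := B'.erase) x y hΘ.erase (LCtx.erase_eq_none hx)
        (LCtx.erase_eq_none hy) hxy
        (by rw [hΓ, LCtx.erase_extend, LCtx.erase_extend, hA, hB]) D₁.erase D₂.erase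
  | _, _, _, _, .ite i hΘ hΓi hAi hΓ hA D₁ D₂ D₃ =>
      .ite i (by have h := hΘ.erase; rwa [hΓi, LCtx.erase_paint] at h) D₁.erase
        (D₂.erase.recast rfl (by rw [hAi, LTy.paint, LTy.erase_map]))
        (D₃.erase.recast hΓ.symm (by rw [hAi, LTy.paint, LTy.erase_map, hA]))
  | _, _, _, _, .op i c hA hΓ =>
      .op i c (by rw [hA, LTy.paint, LTy.erase_map, LTy.erase_plain])
        (by rw [hΓ, LCtx.erase_empty])

end QLam

namespace QLam

universe u v

/-! ### Polarities, labels and contexts -/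

/-! The colors in the conclusion of a colored derivation record where a token ends up when it
climbs: going up along `Vert` from an occurrence of an atom, either a synchronization point of some
index is reached, and this index is the color, or the climb ends at a unit axiom and there is no
color. The graph can then be computed rule by rule, because every edge comes from exactly one link
between two premises.

The second fact rests on polarities. They are constant along `Vert` and reversed by `Cut`. A token
moves down or across only at positive positions and up only at negative ones, so a simple path from
a positive to a negative position goes down, crosses exactly one link, and climbs. Hence the edges
are the pairs of origins of the two ends of a link, the positive end being the source
(`Deriv.syncGraph_edges`).

Climbing from inside a premise never leaves it (`IsPremise.origin`), so the links inside a premise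
contribute exactly the edges of that premise. The links of the last rule contribute `matchEdges`,
once the origins at their ends are known to be the colors (`linkEdges_eq_matchEdges`). That
knowledge is the invariant `HasColors`, proved together with the equality of graphs by induction in
`CDeriv.hasColors_and_graph_eq`.

Conversely, the colored rules constrain their premises only up to erasure of colors, so colored
premises can always be combined (`Deriv.exists_colored`). The statement on acyclicity follows from
these two results. -/

theorem Pol.flip_flip (a : Pol) : a.flip.flip = a := by cases a <;> rfl

theorem Pol.map_flip_eq {o : Option Pol} {a : Pol} : o.map Pol.flip = some a ↔ o = some a.flip := by
  rcases o with _ | b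
  · simp
  · cases a <;> cases b <;> simp [Pol.flip]

theorem LTy.polAt_map {L : Type u} {L' : Type v} (f : L → L') (A : LTy L) (p : Path) :
    (A.map f).polAt p = A.polAt p := by
  induction A generalizing p with
  | atom a l => cases p <;> rfl
  | lolli A B ihA ihB => rcases p with _ | ⟨_ | _, p⟩ <;> simp [LTy.map, LTy.polAt, ihA, ihB]
  | tensor A B ihA ihB => rcases p with _ | ⟨_ | _, p⟩ <;> simp [LTy.map, LTy.polAt, ihA, ihB]

theorem LTy.polAt_erase {L : Type u} (A : LTy L) (p : Path) : A.erase.polAt p = A.polAt p :=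
  A.polAt_map _ p

theorem LTy.labelAt_map {L : Type u} {L' : Type v} (f : L → L') (A : LTy L) (p : Path) :
    (A.map f).labelAt p = (A.labelAt p).map f := by
  induction A generalizing p with
  | atom a l => cases p <;> rfl
  | lolli A B ihA ihB => rcases p with _ | ⟨_ | _, p⟩ <;> simp [LTy.map, LTy.labelAt, ihA, ihB]
  | tensor A B ihA ihB => rcases p with _ | ⟨_ | _, p⟩ <;> simp [LTy.map, LTy.labelAt, ihA, ihB]

theorem LTy.exists_labelAt {L : Type u} {A : LTy L} {p : Path} (h : A.polAt p ≠ none) :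
    ∃ l, A.labelAt p = some l := by
  induction A generalizing p with
  | atom a l =>
    cases p with
    | nil => exact ⟨l, rfl⟩
    | cons a p => exact absurd rfl h
  | lolli A B ihA ihB =>
    rcases p with _ | ⟨_ | _, p⟩
    · exact absurd rfl h
    · exact ihA fun h' => h (by simp [LTy.polAt, h'])
    · exact ihB h
  | tensor A B ihA ihB =>
    rcases p with _ | ⟨_ | _, p⟩
    · exact absurd rfl h
    · exact ihA h
    · exact ihB h

theorem LTy.colorAt_map_some {I : Type u} (ι : LTy I) (p : Path) :
    LTy.colorAt (ι.map some) p = ι.labelAt p := by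
  rw [LTy.colorAt, LTy.labelAt_map]
  cases ι.labelAt p <;> rfl

theorem LTy.colorAt_paint {L : Type u} {I : Type v} (i : I) {A : LTy L} {p : Path}
    (h : A.polAt p ≠ none) : (A.paint i).colorAt p = some i := by
  obtain ⟨l, hl⟩ := LTy.exists_labelAt h
  simp [LTy.colorAt, LTy.paint, LTy.labelAt_map, hl]

theorem LCtx.Split.eq_left {L : Type u} {Θ Δ Γ : LCtx L} (h : LCtx.Split Θ Δ Γ) {x : Var}
    (hx : Δ x ≠ none) : Θ x = Δ x ∧ Γ x = none := by
  rcases h x with ⟨h₁, h₂⟩ | ⟨h₁, h₂⟩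
  · exact ⟨h₂, h₁⟩
  · exact absurd h₁ hx

theorem LCtx.Split.symm {L : Type u} {Θ Δ Γ : LCtx L} (h : LCtx.Split Θ Δ Γ) :
    LCtx.Split Θ Γ Δ := fun x => (h x).symm

theorem LCtx.Split.eq_right {L : Type u} {Θ Δ Γ : LCtx L} (h : LCtx.Split Θ Δ Γ) {x : Var}
    (hx : Γ x ≠ none) : Θ x = Γ x ∧ Δ x = none := h.symm.eq_left hx

theorem LCtx.extend_of_ne_none {L : Type u} {Γ : LCtx L} {x y : Var} (A : LTy L)
    (hx : Γ x = none) (hy : Γ y ≠ none) : Γ.extend x A y = Γ y := by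
  have : y ≠ x := fun h => hy (h ▸ hx)
  simp [LCtx.extend, this]

theorem LCtx.extend_self {L : Type u} (Γ : LCtx L) (x : Var) (A : LTy L) :
    Γ.extend x A x = some A := by simp [LCtx.extend]

theorem LCtx.extend_of_ne {L : Type u} (Γ : LCtx L) {x y : Var} (A : LTy L) (h : y ≠ x) :
    Γ.extend x A y = Γ y := by simp [LCtx.extend, h]

theorem LCtx.erase_eq_none_iff {L : Type u} {Γ : LCtx L} {x : Var} :
    Γ.erase x = none ↔ Γ x = none := by simp [LCtx.erase, LCtx.map]

/-! ### Premises of a derivation -/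

/-- `d'` behaves, inside `d`, as the derivation of the premise number `k`. -/
structure IsPremise {I : Type u} {Γ Γ' : Ctx} {M M' : Tm} {A A' : Ty} (d : Deriv I Γ M A) (k : ℕ)
    (d' : Deriv I Γ' M' A') : Prop where
  pol : ∀ σ, d.pol (σ.under k) = d'.pol σ
  vert : ∀ σ τ, d.Vert (σ.under k) τ ↔ ∃ τ', d'.Vert σ τ' ∧ τ = τ'.under k
  inSync : ∀ i σ, d.InSync i (σ.under k) ↔ d'.InSync i σ

theorem Pos.under_eq_under {k k' : ℕ} {σ τ : Pos} :
    σ.under k = τ.under k' ↔ k = k' ∧ σ = τ := by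
  cases σ; cases τ; simp [Pos.under, and_assoc]

theorem liftRel_under {k k' : ℕ} {R : Pos → Pos → Prop} {σ τ : Pos} :
    liftRel k R (σ.under k') τ ↔ k' = k ∧ ∃ τ', R σ τ' ∧ τ = τ'.under k := by
  simp only [liftRel, Pos.under_eq_under]
  aesop

theorem liftPred_under {k k' : ℕ} {R : Pos → Prop} {σ : Pos} :
    liftPred k R (σ.under k') ↔ k' = k ∧ R σ := by
  simp only [liftPred, Pos.under_eq_under]
  aesop

theorem liftRel_root {k : ℕ} {R : Pos → Pos → Prop} {l : Option Var} {p : Path} {τ : Pos} :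
    ¬ liftRel k R ⟨[], l, p⟩ τ := by rintro ⟨σ', τ', -, h, -⟩; simp [Pos.under] at h

theorem liftPred_root {k : ℕ} {R : Pos → Prop} {l : Option Var} {p : Path} :
    ¬ liftPred k R ⟨[], l, p⟩ := by rintro ⟨σ', -, h⟩; simp [Pos.under] at h

theorem ctxWire_under {Γ : Ctx} {k k' : ℕ} {σ τ : Pos} : ¬ CtxWire Γ k (σ.under k') τ := nofun

theorem lamWire_under {x : Var} {k' : ℕ} {σ τ : Pos} : ¬ LamWire x (σ.under k') τ := nofun

theorem appWire_under {k' : ℕ} {σ τ : Pos} : ¬ AppWire (σ.under k') τ := nofun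

theorem pairWire_under {k' : ℕ} {σ τ : Pos} : ¬ PairWire (σ.under k') τ := nofun

theorem letWire_under {k' : ℕ} {σ τ : Pos} : ¬ LetWire (σ.under k') τ := nofun

section Premises

variable {I : Type u} {Θ Δ Γ Γ' : Ctx} {M N P : Tm} {A B C : Ty}

theorem isPremise_lam {x : Var} {hx : Γ x = none} {hΓ : Γ' = Γ.extend x A} {d : Deriv I Γ' M B} :
    IsPremise (.lam x hx hΓ d) 0 d := by
  constructor <;> intros
  · rfl
  · simp [Deriv.Vert, ctxWire_under, lamWire_under, liftRel_under]
  · simp [Deriv.InSync, liftPred_under]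

theorem isPremise_app {hΘ : LCtx.Split Θ Δ Γ} {d₁ : Deriv I Δ M (.lolli A B)}
    {d₂ : Deriv I Γ N A} : IsPremise (.app hΘ d₁ d₂) 0 d₁ ∧ IsPremise (.app hΘ d₁ d₂) 1 d₂ := by
  constructor <;> constructor <;> intros
  any_goals rfl
  all_goals simp [Deriv.Vert, Deriv.InSync, ctxWire_under, appWire_under, liftRel_under,
    liftPred_under]

theorem isPremise_letStar {hΘ : LCtx.Split Θ Δ Γ} {d₁ : Deriv I Δ M (.atom .one ())}
    {d₂ : Deriv I Γ N A} :
    IsPremise (.letStar hΘ d₁ d₂) 0 d₁ ∧ IsPremise (.letStar hΘ d₁ d₂) 1 d₂ := by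
  constructor <;> constructor <;> intros
  any_goals rfl
  all_goals simp [Deriv.Vert, Deriv.InSync, ctxWire_under, letWire_under, liftRel_under,
    liftPred_under]

theorem isPremise_pair {hΘ : LCtx.Split Θ Δ Γ} {d₁ : Deriv I Δ M A} {d₂ : Deriv I Γ N B} :
    IsPremise (.pair hΘ d₁ d₂) 0 d₁ ∧ IsPremise (.pair hΘ d₁ d₂) 1 d₂ := by
  constructor <;> constructor <;> intros
  any_goals rfl
  all_goals simp [Deriv.Vert, Deriv.InSync, ctxWire_under, pairWire_under, liftRel_under,
    liftPred_under]

theorem isPremise_letPair {x y : Var} {hΘ : LCtx.Split Θ Δ Γ} {hx : Γ x = none} {hy : Γ y = none}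
    {hxy : x ≠ y} {hΓ : Γ' = (Γ.extend x A).extend y B} {d₁ : Deriv I Δ M (.tensor A B)}
    {d₂ : Deriv I Γ' N C} :
    IsPremise (.letPair x y hΘ hx hy hxy hΓ d₁ d₂) 0 d₁ ∧
      IsPremise (.letPair x y hΘ hx hy hxy hΓ d₁ d₂) 1 d₂ := by
  constructor <;> constructor <;> intros
  any_goals rfl
  all_goals simp [Deriv.Vert, Deriv.InSync, ctxWire_under, letWire_under, liftRel_under,
    liftPred_under]

theorem isPremise_ite {i : I} {hΘ : LCtx.Split Θ Δ Γ} {d₁ : Deriv I Δ M (.atom .bit ())}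
    {d₂ : Deriv I Γ N A} {d₃ : Deriv I Γ P A} :
    IsPremise (.ite i hΘ d₁ d₂ d₃) 0 d₁ ∧ IsPremise (.ite i hΘ d₁ d₂ d₃) 1 d₂ ∧
      IsPremise (.ite i hΘ d₁ d₂ d₃) 2 d₃ := by
  refine ⟨?_, ?_, ?_⟩ <;> constructor <;> intros
  any_goals rfl
  all_goals simp [Deriv.Vert, Deriv.InSync, ctxWire_under, liftRel_under, liftPred_under]
  -- What remains comes from the root clause in `InSync` for the conditional: an address starting
  -- with a premise number is not empty.
  all_goals simp [Pos.under]

end Premises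

/-! ### Polarities along moves -/

/-- The function `f` covers both uses: the identity for `Vert`, the reversal of polarity for `Cut`.
-/
theorem IsPremise.pol_eq_of_liftRel {I : Type u} {Γ Γ' : Ctx} {M M' : Tm} {A A' : Ty}
    {d : Deriv I Γ M A} {k : ℕ} {d' : Deriv I Γ' M' A'} (h : IsPremise d k d')
    {R : Pos → Pos → Prop} {f : Option Pol → Option Pol}
    (hR : ∀ σ τ, R σ τ → d'.pol σ = f (d'.pol τ)) {σ τ : Pos} (hl : liftRel k R σ τ) :
    d.pol σ = f (d.pol τ) := by
  obtain ⟨σ', τ', hr, rfl, rfl⟩ := hl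
  rw [h.pol, h.pol, hR _ _ hr]

theorem IsPremise.pol_ctxWire {I : Type u} {Γ Γ' Δ : Ctx} {M M' : Tm} {A A' : Ty}
    {d : Deriv I Γ M A} {k : ℕ} {d' : Deriv I Γ' M' A'} (h : IsPremise d k d')
    (hΔ : ∀ y, Δ y ≠ none → Γ y = Γ' y) {σ τ : Pos} (hl : CtxWire Δ k σ τ) :
    d.pol σ = d.pol τ := by
  obtain ⟨y, p, hy⟩ := hl
  have := h.pol ⟨[], some y, p⟩
  simp only [Pos.under] at this
  rw [this]
  simp [Deriv.pol, Deriv.polAt, seqPol, hΔ y hy]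

/-- The one case where an occurrence changes side is the abstraction: the argument type leaves the
left of `⊸` for the context, and both places reverse polarity. -/
theorem Deriv.pol_eq_of_vert {I : Type u} {Γ : Ctx} {M : Tm} {A : Ty} (d : Deriv I Γ M A)
    {σ τ : Pos} (h : d.Vert σ τ) : d.pol σ = d.pol τ := by
  induction d generalizing σ τ with
  | ax | star | op => exact h.elim
  | lam x hx hΓ d ih =>
    have hp := isPremise_lam (hx := hx) (hΓ := hΓ) (d := d)
    rcases h with h | h | h
    · exact hp.pol_ctxWire (fun y hy => by rw [hΓ, LCtx.extend_of_ne_none _ hx hy]) h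
    · subst hΓ
      cases h <;> simp [Deriv.pol, Deriv.polAt, seqPol, LTy.polAt, LCtx.extend_self]
    · exact hp.pol_eq_of_liftRel (f := id) (fun σ τ => ih) h
  | app hΘ d₁ d₂ ih₁ ih₂ =>
    obtain ⟨hp₁, hp₂⟩ := isPremise_app (hΘ := hΘ) (d₁ := d₁) (d₂ := d₂)
    rcases h with h | h | h | h | h
    · exact hp₁.pol_ctxWire (fun y hy => (hΘ.eq_left hy).1) h
    · exact hp₂.pol_ctxWire (fun y hy => (hΘ.eq_right hy).1) h
    · cases h; simp [Deriv.pol, Deriv.polAt, seqPol, LTy.polAt]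
    · exact hp₁.pol_eq_of_liftRel (f := id) (fun σ τ => ih₁) h
    · exact hp₂.pol_eq_of_liftRel (f := id) (fun σ τ => ih₂) h
  | letStar hΘ d₁ d₂ ih₁ ih₂ =>
    obtain ⟨hp₁, hp₂⟩ := isPremise_letStar (hΘ := hΘ) (d₁ := d₁) (d₂ := d₂)
    rcases h with h | h | h | h | h
    · exact hp₁.pol_ctxWire (fun y hy => (hΘ.eq_left hy).1) h
    · exact hp₂.pol_ctxWire (fun y hy => (hΘ.eq_right hy).1) h
    · cases h; simp [Deriv.pol, Deriv.polAt, seqPol]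
    · exact hp₁.pol_eq_of_liftRel (f := id) (fun σ τ => ih₁) h
    · exact hp₂.pol_eq_of_liftRel (f := id) (fun σ τ => ih₂) h
  | pair hΘ d₁ d₂ ih₁ ih₂ =>
    obtain ⟨hp₁, hp₂⟩ := isPremise_pair (hΘ := hΘ) (d₁ := d₁) (d₂ := d₂)
    rcases h with h | h | h | h | h
    · exact hp₁.pol_ctxWire (fun y hy => (hΘ.eq_left hy).1) h
    · exact hp₂.pol_ctxWire (fun y hy => (hΘ.eq_right hy).1) h
    · cases h <;> simp [Deriv.pol, Deriv.polAt, seqPol, LTy.polAt]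
    · exact hp₁.pol_eq_of_liftRel (f := id) (fun σ τ => ih₁) h
    · exact hp₂.pol_eq_of_liftRel (f := id) (fun σ τ => ih₂) h
  | letPair x y hΘ hx hy hxy hΓ d₁ d₂ ih₁ ih₂ =>
    obtain ⟨hp₁, hp₂⟩ := isPremise_letPair (hΘ := hΘ) (hx := hx) (hy := hy) (hxy := hxy)
      (hΓ := hΓ) (d₁ := d₁) (d₂ := d₂)
    rcases h with h | h | h | h | h
    · exact hp₁.pol_ctxWire (fun y hy => (hΘ.eq_left hy).1) h
    · refine hp₂.pol_ctxWire (fun z hz => ?_) h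
      have hzx : z ≠ x := fun e => hz (e ▸ hx)
      have hzy : z ≠ y := fun e => hz (e ▸ hy)
      rw [hΓ, LCtx.extend_of_ne _ _ hzy, LCtx.extend_of_ne _ _ hzx, (hΘ.eq_right hz).1]
    · cases h; simp [Deriv.pol, Deriv.polAt, seqPol]
    · exact hp₁.pol_eq_of_liftRel (f := id) (fun σ τ => ih₁) h
    · exact hp₂.pol_eq_of_liftRel (f := id) (fun σ τ => ih₂) h
  | ite i hΘ d₁ d₂ d₃ ih₁ ih₂ ih₃ =>
    obtain ⟨hp₁, hp₂, hp₃⟩ := isPremise_ite (i := i) (hΘ := hΘ) (d₁ := d₁) (d₂ := d₂) (d₃ := d₃)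
    rcases h with h | h | h | h
    · exact hp₁.pol_ctxWire (fun y hy => (hΘ.eq_left hy).1) h
    · exact hp₁.pol_eq_of_liftRel (f := id) (fun σ τ => ih₁) h
    · exact hp₂.pol_eq_of_liftRel (f := id) (fun σ τ => ih₂) h
    · exact hp₃.pol_eq_of_liftRel (f := id) (fun σ τ => ih₃) h

/-- Of the two linked copies exactly one stands under a reversal: to the left of `⊸` in an
application, in the context in `letPair`. -/
theorem Deriv.pol_eq_of_cut {I : Type u} {Γ : Ctx} {M : Tm} {A : Ty} (d : Deriv I Γ M A)
    {σ τ : Pos} (h : d.Cut σ τ) : d.pol σ = (d.pol τ).map Pol.flip := by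
  induction d generalizing σ τ with
  | ax | star | op => exact h.elim
  | lam x hx hΓ d ih =>
    exact (isPremise_lam (hx := hx) (hΓ := hΓ)).pol_eq_of_liftRel (fun σ τ => ih) h
  | app hΘ d₁ d₂ ih₁ ih₂ =>
    obtain ⟨hp₁, hp₂⟩ := isPremise_app (hΘ := hΘ) (d₁ := d₁) (d₂ := d₂)
    rcases h with h | h | h
    · cases h; simp [Deriv.pol, Deriv.polAt, seqPol, LTy.polAt]
    · exact hp₁.pol_eq_of_liftRel (fun σ τ => ih₁) h
    · exact hp₂.pol_eq_of_liftRel (fun σ τ => ih₂) h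
  | letStar hΘ d₁ d₂ ih₁ ih₂ =>
    obtain ⟨hp₁, hp₂⟩ := isPremise_letStar (hΘ := hΘ) (d₁ := d₁) (d₂ := d₂)
    rcases h with h | h
    · exact hp₁.pol_eq_of_liftRel (fun σ τ => ih₁) h
    · exact hp₂.pol_eq_of_liftRel (fun σ τ => ih₂) h
  | pair hΘ d₁ d₂ ih₁ ih₂ =>
    obtain ⟨hp₁, hp₂⟩ := isPremise_pair (hΘ := hΘ) (d₁ := d₁) (d₂ := d₂)
    rcases h with h | h
    · exact hp₁.pol_eq_of_liftRel (fun σ τ => ih₁) h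
    · exact hp₂.pol_eq_of_liftRel (fun σ τ => ih₂) h
  | letPair x y hΘ hx hy hxy hΓ d₁ d₂ ih₁ ih₂ =>
    obtain ⟨hp₁, hp₂⟩ := isPremise_letPair (hΘ := hΘ) (hx := hx) (hy := hy) (hxy := hxy)
      (hΓ := hΓ) (d₁ := d₁) (d₂ := d₂)
    rcases h with h | h | h
    · subst hΓ
      cases h <;> simp [Deriv.pol, Deriv.polAt, seqPol, LTy.polAt, LCtx.extend_self,
        LCtx.extend_of_ne _ _ hxy, Pol.flip_flip, Function.comp_def]
    · exact hp₁.pol_eq_of_liftRel (fun σ τ => ih₁) h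
    · exact hp₂.pol_eq_of_liftRel (fun σ τ => ih₂) h
  | ite i hΘ d₁ d₂ d₃ ih₁ ih₂ ih₃ =>
    obtain ⟨hp₁, hp₂, hp₃⟩ := isPremise_ite (i := i) (hΘ := hΘ) (d₁ := d₁) (d₂ := d₂) (d₃ := d₃)
    rcases h with h | h | h
    · exact hp₁.pol_eq_of_liftRel (fun σ τ => ih₁) h
    · exact hp₂.pol_eq_of_liftRel (fun σ τ => ih₂) h
    · exact hp₃.pol_eq_of_liftRel (fun σ τ => ih₃) h

/-! ### Simple paths between synchronization points -/

section Paths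

variable {I : Type u} {Γ Γ' : Ctx} {M M' : Tm} {A A' : Ty}

/-- Going up from `σ`, one reaches the conclusion of a synchronization point of index `i`. -/
def Deriv.Origin (d : Deriv I Γ M A) (i : I) (σ : Pos) : Prop :=
  ∃ τ, Relation.ReflTransGen d.Vert σ τ ∧ d.InSync i τ

/-- The edges created by the links in `R`. -/
def Deriv.linkEdges (d : Deriv I Γ M A) (R : Pos → Pos → Prop) : Set (I × I) :=
  {e | ∃ σ τ, (R σ τ ∨ R τ σ) ∧ d.pol σ = some .pos ∧ d.Origin e.1 σ ∧ d.Origin e.2 τ}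

theorem Deriv.pol_eq_of_verts (d : Deriv I Γ M A) {σ τ : Pos}
    (h : Relation.ReflTransGen d.Vert σ τ) : d.pol σ = d.pol τ := by
  induction h with
  | refl => rfl
  | tail _ h ih => exact ih.trans (d.pol_eq_of_vert h)

theorem Deriv.pol_of_linked (d : Deriv I Γ M A) {σ τ : Pos} (h : d.Cut σ τ ∨ d.Cut τ σ)
    (hσ : d.pol σ = some .pos) : d.pol τ = some .neg := by
  rcases h with h | h
  · rw [d.pol_eq_of_cut h, Pol.map_flip_eq] at hσ
    exact hσ
  · rw [d.pol_eq_of_cut h, hσ]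
    rfl

/-- A simple path goes down along positive positions, crosses at most one link, and then goes up
along negative positions. -/
theorem Deriv.SimplePath.decompose {d : Deriv I Γ M A} {σ τ : Pos} (h : d.SimplePath σ τ)
    (hτ : d.pol τ = some .neg) :
    (d.pol σ = some .neg → Relation.ReflTransGen d.Vert σ τ) ∧
    (d.pol σ = some .pos → ∃ σ' τ', Relation.ReflTransGen d.Vert σ' σ ∧
      (d.Cut σ' τ' ∨ d.Cut τ' σ') ∧ Relation.ReflTransGen d.Vert τ' τ) := by
  -- Induction on the first move, with both claims at once: a negative start leaves only climbing,
  -- and the positive case falls back on the negative one after the crossing.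
  induction h using Relation.ReflTransGen.head_induction_on with
  | refl => exact ⟨fun _ => .refl, fun h => by simp [hτ] at h⟩
  | head hm _ ih =>
    cases hm with
    | up hv hp =>
      rw [← d.pol_eq_of_vert hv] at ih
      exact ⟨fun h => (ih.1 h).head hv, fun h => by simp [hp] at h⟩
    | down hv hp =>
      rw [d.pol_eq_of_vert hv] at ih
      refine ⟨fun h => by simp [hp] at h, fun h => ?_⟩
      obtain ⟨σ', τ', h₁, h₂, h₃⟩ := ih.2 h
      exact ⟨σ', τ', h₁.tail hv, h₂, h₃⟩
    | cross hc hp =>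
      -- The far end of the link is negative, so the first half of the induction hypothesis applies
      -- and no second link can be crossed.
      exact ⟨fun h => by simp [hp] at h,
        fun _ => ⟨_, _, .refl, .inl hc, ih.1 (d.pol_of_linked (.inl hc) hp)⟩⟩
    | crossBack hc hp =>
      exact ⟨fun h => by simp [hp] at h,
        fun _ => ⟨_, _, .refl, .inr hc, ih.1 (d.pol_of_linked (.inr hc) hp)⟩⟩

theorem Deriv.simplePath_up {d : Deriv I Γ M A} {σ τ : Pos}
    (h : Relation.ReflTransGen d.Vert σ τ) (hσ : d.pol σ = some .neg) : d.SimplePath σ τ := by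
  induction h with
  | refl => exact .refl
  | tail h hv ih => exact ih.tail (.up hv (by rw [← d.pol_eq_of_verts h, hσ]))

theorem Deriv.simplePath_down {d : Deriv I Γ M A} {σ τ : Pos}
    (h : Relation.ReflTransGen d.Vert σ τ) (hσ : d.pol σ = some .pos) : d.SimplePath τ σ := by
  induction h with
  | refl => exact .refl
  | tail h hv ih =>
    exact ih.head (.down hv (by rw [← d.pol_eq_of_vert hv, ← d.pol_eq_of_verts h, hσ]))

/-- The global reachability condition becomes local to links: the descending and climbing parts of a
path, read from its link, are exactly the two witnesses of `Origin`. -/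
theorem Deriv.syncGraph_edges (d : Deriv I Γ M A) : d.syncGraph.edges = d.linkEdges d.Cut := by
  ext ⟨i, j⟩
  constructor
  · rintro ⟨σ, τ, hi, hσ, hj, hτ, h⟩
    obtain ⟨σ', τ', h₁, h₂, h₃⟩ := (h.decompose hτ).2 hσ
    exact ⟨σ', τ', h₂, by rw [d.pol_eq_of_verts h₁, hσ], ⟨σ, h₁, hi⟩, ⟨τ, h₃, hj⟩⟩
  · rintro ⟨σ', τ', h, hσ', ⟨σ, h₁, hi⟩, ⟨τ, h₂, hj⟩⟩
    have hτ' := d.pol_of_linked h hσ'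
    refine ⟨σ, τ, hi, by rw [← d.pol_eq_of_verts h₁, hσ'], hj,
      by rw [← d.pol_eq_of_verts h₂, hτ'], (simplePath_down h₁ hσ').trans
        (.head ?_ (simplePath_up h₂ hτ'))⟩
    rcases h with h | h
    · exact .cross h hσ'
    · exact .crossBack h hσ'

theorem Deriv.origin_iff (d : Deriv I Γ M A) (i : I) (σ : Pos) :
    d.Origin i σ ↔ d.InSync i σ ∨ ∃ τ, d.Vert σ τ ∧ d.Origin i τ := by
  constructor
  · rintro ⟨τ, h, hi⟩
    rcases h.cases_head with rfl | ⟨ρ, hv, h⟩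
    · exact .inl hi
    · exact .inr ⟨ρ, hv, τ, h, hi⟩
  · rintro (h | ⟨ρ, hv, τ, h, hi⟩)
    · exact ⟨σ, .refl, h⟩
    · exact ⟨τ, h.head hv, hi⟩

/-- `Vert` from a position of a premise stays in that premise, so origins may be computed in the
subderivation alone. -/
theorem IsPremise.origin {d : Deriv I Γ M A} {k : ℕ} {d' : Deriv I Γ' M' A'}
    (h : IsPremise d k d') (i : I) (σ : Pos) : d.Origin i (σ.under k) ↔ d'.Origin i σ := by
  constructor
  · rintro ⟨τ, hv, hi⟩
    -- The end of the climb is not known in advance to lie in the premise; this is proved along with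
    -- the lifted path.
    suffices ∃ τ', τ = τ'.under k ∧ Relation.ReflTransGen d'.Vert σ τ' by
      obtain ⟨τ', rfl, hv'⟩ := this
      exact ⟨τ', hv', (h.inSync _ _).1 hi⟩
    clear hi
    induction hv with
    | refl => exact ⟨σ, rfl, .refl⟩
    | tail _ hv ih =>
      obtain ⟨τ', rfl, hv'⟩ := ih
      obtain ⟨ρ, hρ, rfl⟩ := (h.vert _ _).1 hv
      exact ⟨ρ, rfl, hv'.tail hρ⟩
  · rintro ⟨τ, hv, hi⟩
    exact ⟨τ.under k, hv.lift _ fun a b hab => (h.vert _ _).2 ⟨b, hab, rfl⟩, (h.inSync _ _).2 hi⟩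

/-- A position with a single wire upwards, and outside any synchronization point, inherits its
origins from the other end of the wire. -/
theorem IsPremise.origin_of_vert {d : Deriv I Γ M A} {k : ℕ} {d' : Deriv I Γ' M' A'}
    (h : IsPremise d k d') {i : I} {σ ρ : Pos} (hS : ¬ d.InSync i σ)
    (hV : ∀ τ, d.Vert σ τ ↔ τ = ρ.under k) : d.Origin i σ ↔ d'.Origin i ρ := by
  rw [d.origin_iff]
  simp [hS, hV, h.origin]

/-- Keeping the set of links as a parameter separates those of the last rule from those of each
premise. -/
theorem Deriv.linkEdges_or (d : Deriv I Γ M A) (R S : Pos → Pos → Prop) :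
    d.linkEdges (fun σ τ => R σ τ ∨ S σ τ) = d.linkEdges R ∪ d.linkEdges S := by
  ext e
  constructor
  · rintro ⟨σ, τ, (h | h) | (h | h), h'⟩
    · exact .inl ⟨σ, τ, .inl h, h'⟩
    · exact .inr ⟨σ, τ, .inl h, h'⟩
    · exact .inl ⟨σ, τ, .inr h, h'⟩
    · exact .inr ⟨σ, τ, .inr h, h'⟩
  · rintro (⟨σ, τ, h | h, h'⟩ | ⟨σ, τ, h | h, h'⟩)
    · exact ⟨σ, τ, .inl (.inl h), h'⟩
    · exact ⟨σ, τ, .inr (.inl h), h'⟩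
    · exact ⟨σ, τ, .inl (.inr h), h'⟩
    · exact ⟨σ, τ, .inr (.inr h), h'⟩

theorem Deriv.linkEdges_false (d : Deriv I Γ M A) :
    d.linkEdges (fun _ _ => False) = ∅ := by
  simp [Deriv.linkEdges]

theorem Deriv.linkEdges_swap (d : Deriv I Γ M A) (R : Pos → Pos → Prop) :
    d.linkEdges (fun σ τ => R τ σ) = d.linkEdges R := by
  simp only [Deriv.linkEdges, or_comm]

/-- Polarities and origins of positions of the premise are the same in the whole derivation, so its
links create the same edges in both. -/
theorem IsPremise.linkEdges {d : Deriv I Γ M A} {k : ℕ} {d' : Deriv I Γ' M' A'}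
    (h : IsPremise d k d') : d.linkEdges (liftRel k d'.Cut) = d'.syncGraph.edges := by
  rw [d'.syncGraph_edges]
  ext e
  constructor
  · rintro ⟨_, _, ⟨σ, τ, hc, rfl, rfl⟩ | ⟨τ, σ, hc, rfl, rfl⟩, h'⟩ <;>
      simp only [h.pol, h.origin] at h'
    · exact ⟨σ, τ, .inl hc, h'⟩
    · exact ⟨σ, τ, .inr hc, h'⟩
  · rintro ⟨σ, τ, hc, h'⟩
    refine ⟨σ.under k, τ.under k, ?_, by simpa only [h.pol, h.origin] using h'⟩
    rcases hc with hc | hc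
    · exact .inl ⟨_, _, hc, rfl, rfl⟩
    · exact .inr ⟨_, _, hc, rfl, rfl⟩

end Paths

/-! ### Colors of the conclusion -/

/-- The color of an occurrence of an atom in a colored judgment `Γ ⊢ M : A`. -/
def seqColor {I : Type u} (Γ : CCtx I) (A : CTy I) : Option Var → Path → Option I
  | none, p => A.colorAt p
  | some x, p => (Γ x).bind fun B => B.colorAt p

/-! ### Wires leaving each kind of position of the conclusion. -/

theorem ctxWire_some {Γ : Ctx} {k : ℕ} {y : Var} {p : Path} {τ : Pos} :
    CtxWire Γ k ⟨[], some y, p⟩ τ ↔ Γ y ≠ none ∧ τ = ⟨[k], some y, p⟩ :=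
  ⟨fun h => by cases h with | mk _ _ hy => exact ⟨hy, rfl⟩, fun ⟨hy, e⟩ => e ▸ .mk y p hy⟩

theorem ctxWire_none {Γ : Ctx} {k : ℕ} {p : Path} {τ : Pos} :
    ¬ CtxWire Γ k ⟨[], none, p⟩ τ := nofun

theorem lamWire_some {x y : Var} {p : Path} {τ : Pos} : ¬ LamWire x ⟨[], some y, p⟩ τ := nofun

theorem lamWire_left {x : Var} {p : Path} {τ : Pos} :
    LamWire x ⟨[], none, .left :: p⟩ τ ↔ τ = ⟨[0], some x, p⟩ :=
  ⟨fun h => by cases h; rfl, fun e => e ▸ .arg p⟩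

theorem lamWire_right {x : Var} {p : Path} {τ : Pos} :
    LamWire x ⟨[], none, .right :: p⟩ τ ↔ τ = ⟨[0], none, p⟩ :=
  ⟨fun h => by cases h; rfl, fun e => e ▸ .res p⟩

theorem appWire_some {y : Var} {p : Path} {τ : Pos} : ¬ AppWire ⟨[], some y, p⟩ τ := nofun

theorem appWire_none {p : Path} {τ : Pos} :
    AppWire ⟨[], none, p⟩ τ ↔ τ = ⟨[0], none, .right :: p⟩ :=
  ⟨fun h => by cases h; rfl, fun e => e ▸ .res p⟩

theorem letWire_some {y : Var} {p : Path} {τ : Pos} : ¬ LetWire ⟨[], some y, p⟩ τ := nofun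

theorem letWire_none {p : Path} {τ : Pos} :
    LetWire ⟨[], none, p⟩ τ ↔ τ = ⟨[1], none, p⟩ :=
  ⟨fun h => by cases h; rfl, fun e => e ▸ .res p⟩

theorem pairWire_some {y : Var} {p : Path} {τ : Pos} : ¬ PairWire ⟨[], some y, p⟩ τ := nofun

theorem pairWire_left {p : Path} {τ : Pos} :
    PairWire ⟨[], none, .left :: p⟩ τ ↔ τ = ⟨[0], none, p⟩ :=
  ⟨fun h => by cases h; rfl, fun e => e ▸ .fst p⟩

theorem pairWire_right {p : Path} {τ : Pos} :
    PairWire ⟨[], none, .right :: p⟩ τ ↔ τ = ⟨[1], none, p⟩ :=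
  ⟨fun h => by cases h; rfl, fun e => e ▸ .snd p⟩

/-- The colors of `Γ` and `A` are the indices of the synchronization points reached from the
conclusion of `d`. -/
def Deriv.HasColors {I : Type u} {Γ₀ : Ctx} {M : Tm} {A₀ : Ty} (d : Deriv I Γ₀ M A₀)
    (Γ : CCtx I) (A : CTy I) : Prop :=
  ∀ l p i, seqPol Γ₀ A₀ l p ≠ none → (d.Origin i ⟨[], l, p⟩ ↔ seqColor Γ A l p = some i)

/-- The common step of the rule-by-rule verification of `HasColors`: a conclusion occurrence takes
its color from the unique premise occurrence wired to it. -/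
theorem IsPremise.origin_root {I : Type u} {Γ₀ Γ₀' : Ctx} {M M' : Tm} {A₀ A₀' : Ty}
    {d : Deriv I Γ₀ M A₀} {k : ℕ} {d' : Deriv I Γ₀' M' A₀'} (h : IsPremise d k d')
    {Γ : CCtx I} {A : CTy I} (hd : d'.HasColors Γ A) {l l' : Option Var} {p p' : Path} {i : I}
    (hpol : seqPol Γ₀ A₀ l p ≠ none) (hS : ¬ d.InSync i ⟨[], l, p⟩)
    (hV : ∀ τ, d.Vert ⟨[], l, p⟩ τ ↔ τ = ⟨[k], l', p'⟩) :
    d.Origin i ⟨[], l, p⟩ ↔ seqColor Γ A l' p' = some i := by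
  rw [h.origin_of_vert (ρ := ⟨[], l', p'⟩) hS hV]
  -- The premise position carries an atom because polarity is preserved along the wire.
  refine hd l' p' i fun hn => hpol ?_
  have h₁ : d.pol ⟨[], l, p⟩ = seqPol Γ₀ A₀ l p := by simp [Deriv.pol, Deriv.polAt]
  have h₂ : d'.pol ⟨[], l', p'⟩ = seqPol Γ₀' A₀' l' p' := by simp [Deriv.pol, Deriv.polAt]
  rw [← h₁, d.pol_eq_of_vert ((hV _).2 rfl), ← hn, ← h₂, ← h.pol]
  rfl

theorem ne_none_of_seqPol {I : Type u} {Γ : CCtx I} {A : Ty} {y : Var} {p : Path}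
    (h : seqPol Γ.erase A (some y) p ≠ none) : ∃ B, Γ y = some B ∧ B.polAt p ≠ none := by
  cases hB : Γ y with
  | none => exact absurd (by simp [seqPol, LCtx.erase_eq_none hB]) h
  | some B =>
    refine ⟨B, rfl, fun h' => h ?_⟩
    have : Γ.erase y = some B.erase := by simp [LCtx.erase, LCtx.map, hB, LTy.erase]
    simp [seqPol, this, LTy.polAt_erase, h']

/-! ### The color invariant, rule by rule. -/

section Rules

variable {I : Type u} {Θ Δ Γ Γ' : CCtx I} {M N P : Tm} {A A' B B' C : CTy I}

/-- The positions in the context of the conclusion of a rule with two premises. -/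
theorem origin_ctx {Γ₁ : Ctx} {M₁ : Tm} {A₀ A₁ A₂ : Ty} (hΘ : LCtx.Split Θ Δ Γ)
    {d : Deriv I Θ.erase M A₀} {d₁ : Deriv I Δ.erase N A₁} {d₂ : Deriv I Γ₁ M₁ A₂}
    (hp₁ : IsPremise d 0 d₁) (hp₂ : IsPremise d 1 d₂) (h₁ : d₁.HasColors Δ A)
    (h₂ : d₂.HasColors Γ' B) (hΓ : ∀ y, Γ y ≠ none → Γ' y = Γ y)
    {y : Var} {p : Path} {i : I} (hpol : seqPol Θ.erase A₀ (some y) p ≠ none)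
    (hS : ¬ d.InSync i ⟨[], some y, p⟩)
    (hV : ∀ τ, d.Vert ⟨[], some y, p⟩ τ ↔
      CtxWire Δ.erase 0 ⟨[], some y, p⟩ τ ∨ CtxWire Γ.erase 1 ⟨[], some y, p⟩ τ) (C : CTy I) :
    d.Origin i ⟨[], some y, p⟩ ↔ seqColor Θ C (some y) p = some i := by
  obtain ⟨B, hB, -⟩ := ne_none_of_seqPol hpol
  -- The two contexts are disjoint, so exactly one of the two context wires leaves this position.
  rcases hΘ y with ⟨h, h'⟩ | ⟨h, h'⟩
  · have hΔ : Δ y ≠ none := by simp [← h', hB]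
    rw [hp₁.origin_root h₁ (l' := some y) (p' := p) hpol hS]
    · simp [seqColor, h']
    · simp [hV, ctxWire_some, LCtx.erase_eq_none_iff, h, hΔ]
  · have hΔ : Γ y ≠ none := by simp [← h', hB]
    rw [hp₂.origin_root h₂ (l' := some y) (p' := p) hpol hS]
    · simp [seqColor, h', hΓ y hΔ]
    · simp [hV, ctxWire_some, LCtx.erase_eq_none_iff, h, hΔ]

/-- The two copies of an atom in an identity axiom belong to the same atomic axiom, hence share its
index. -/
theorem hasColors_ax (x : Var) (ι : LTy I) {Γ₀ : Ctx} {A₀ : Ty} (hA : ι.erase = A₀)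
    (hΓ : Γ₀ = LCtx.single x A₀) :
    (Deriv.ax x ι hA hΓ : Deriv I Γ₀ (.var x) A₀).HasColors (LCtx.single x (ι.map some))
      (ι.map some) := by
  intro l p i h
  rw [Deriv.origin_iff]
  rcases l with _ | y
  · simp [Deriv.InSync, Deriv.Vert, seqColor, LTy.colorAt_map_some]
  · have : y = x := by
      by_contra hne
      refine h ?_
      simp [seqPol, hΓ, LCtx.single, LCtx.extend_of_ne _ _ hne, LCtx.empty]
    subst this
    simp [Deriv.InSync, Deriv.Vert, seqColor, LTy.colorAt_map_some, LCtx.single,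
      LCtx.extend_self]

theorem hasColors_op (i : I) (c : Op) {Γ₀ : Ctx} {A₀ : Ty} (hA : A₀ = c.type)
    (hΓ : Γ₀ = LCtx.empty) :
    (Deriv.op i c hA hΓ : Deriv I Γ₀ (.op c) A₀).HasColors LCtx.empty (c.type.paint i) := by
  intro l p j h
  subst hA hΓ
  rw [Deriv.origin_iff]
  rcases l with _ | y
  -- `InSync` accepts every path here, whereas only atoms are colored; `h` excludes the paths that
  -- end at no atom.
  · simp [Deriv.InSync, Deriv.Vert, seqColor, LTy.colorAt_paint i h, eq_comm]
  · exact absurd (by simp [seqPol, LCtx.empty]) h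

/-- The unit axiom is not a synchronization point, so its atom has no origin, in agreement with the
missing color. -/
theorem hasColors_star {Γ₀ : Ctx} (hΓ : Γ₀ = LCtx.empty) :
    (Deriv.star hΓ : Deriv I Γ₀ .star _).HasColors LCtx.empty (.atom .one none) := by
  intro l p j h
  subst hΓ
  rw [Deriv.origin_iff]
  rcases l with _ | y
  · cases p <;> simp [Deriv.InSync, Deriv.Vert, seqColor, LTy.colorAt, LTy.labelAt]
  · exact absurd (by simp [seqPol, LCtx.empty]) h

theorem hasColors_lam {x : Var} {hx : Γ.erase x = none}
    {hΓ : (Γ.extend x A).erase = Γ.erase.extend x A.erase}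
    {d : Deriv I (Γ.extend x A).erase M B.erase} (h : d.HasColors (Γ.extend x A) B) :
    (Deriv.lam x hx hΓ d).HasColors Γ (.lolli A B) := by
  intro l p i hpol
  have hp := isPremise_lam (hx := hx) (hΓ := hΓ) (d := d)
  rcases l with _ | y
  · rcases p with _ | ⟨_ | _, p⟩
    · exact absurd rfl hpol
    · rw [hp.origin_root h (l' := some x) (p' := p) hpol]
      · simp [seqColor, LCtx.extend_self, LTy.colorAt, LTy.labelAt]
      · exact liftPred_root
      · simp [Deriv.Vert, ctxWire_none, lamWire_left, liftRel_root]
    · rw [hp.origin_root h (l' := none) (p' := p) hpol]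
      · simp [seqColor, LTy.colorAt, LTy.labelAt]
      · exact liftPred_root
      · simp [Deriv.Vert, ctxWire_none, lamWire_right, liftRel_root]
  · obtain ⟨C, hC, -⟩ := ne_none_of_seqPol hpol
    have hy : Γ y ≠ none := by simp [hC]
    rw [hp.origin_root h (l' := some y) (p' := p) hpol]
    · simp [seqColor, LCtx.extend_of_ne_none _ (LCtx.erase_eq_none_iff.1 hx) hy]
    · exact liftPred_root
    · simp [Deriv.Vert, ctxWire_some, lamWire_some, liftRel_root, LCtx.erase_eq_none_iff, hy]

theorem hasColors_app (hΘ : LCtx.Split Θ Δ Γ)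
    {d₁ : Deriv I Δ.erase M (.lolli A.erase B.erase)} {d₂ : Deriv I Γ.erase N A.erase}
    (h₁ : d₁.HasColors Δ (.lolli A B)) (h₂ : d₂.HasColors Γ A') :
    (Deriv.app hΘ.erase d₁ d₂).HasColors Θ B := by
  intro l p i hpol
  obtain ⟨hp₁, hp₂⟩ := isPremise_app (hΘ := hΘ.erase) (d₁ := d₁) (d₂ := d₂)
  rcases l with _ | y
  · rw [hp₁.origin_root h₁ (l' := none) (p' := .right :: p) hpol]
    · simp [seqColor, LTy.colorAt, LTy.labelAt]
    · simp [Deriv.InSync, liftPred_root]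
    · simp [Deriv.Vert, ctxWire_none, appWire_none, liftRel_root]
  · refine origin_ctx hΘ hp₁ hp₂ h₁ h₂ (fun _ _ => rfl) hpol ?_ ?_ _
    · simp [Deriv.InSync, liftPred_root]
    · simp [Deriv.Vert, appWire_some, liftRel_root]

theorem hasColors_letStar {c : Option I} (hΘ : LCtx.Split Θ Δ Γ)
    {d₁ : Deriv I Δ.erase M (.atom .one ())} {d₂ : Deriv I Γ.erase N A.erase}
    (h₁ : d₁.HasColors Δ (.atom .one c)) (h₂ : d₂.HasColors Γ A) :
    (Deriv.letStar hΘ.erase d₁ d₂).HasColors Θ A := by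
  intro l p i hpol
  obtain ⟨hp₁, hp₂⟩ := isPremise_letStar (hΘ := hΘ.erase) (d₁ := d₁) (d₂ := d₂)
  rcases l with _ | y
  · rw [hp₂.origin_root h₂ (l' := none) (p' := p) hpol]
    · simp [seqColor]
    · simp [Deriv.InSync, liftPred_root]
    · simp [Deriv.Vert, ctxWire_none, letWire_none, liftRel_root]
  · refine origin_ctx hΘ hp₁ hp₂ h₁ h₂ (fun _ _ => rfl) hpol ?_ ?_ _
    · simp [Deriv.InSync, liftPred_root]
    · simp [Deriv.Vert, letWire_some, liftRel_root]

theorem hasColors_pair (hΘ : LCtx.Split Θ Δ Γ)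
    {d₁ : Deriv I Δ.erase M A.erase} {d₂ : Deriv I Γ.erase N B.erase}
    (h₁ : d₁.HasColors Δ A) (h₂ : d₂.HasColors Γ B) :
    (Deriv.pair hΘ.erase d₁ d₂).HasColors Θ (.tensor A B) := by
  intro l p i hpol
  obtain ⟨hp₁, hp₂⟩ := isPremise_pair (hΘ := hΘ.erase) (d₁ := d₁) (d₂ := d₂)
  rcases l with _ | y
  · rcases p with _ | ⟨_ | _, p⟩
    · exact absurd rfl hpol
    · rw [hp₁.origin_root h₁ (l' := none) (p' := p) hpol]
      · simp [seqColor, LTy.colorAt, LTy.labelAt]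
      · simp [Deriv.InSync, liftPred_root]
      · simp [Deriv.Vert, ctxWire_none, pairWire_left, liftRel_root]
    · rw [hp₂.origin_root h₂ (l' := none) (p' := p) hpol]
      · simp [seqColor, LTy.colorAt, LTy.labelAt]
      · simp [Deriv.InSync, liftPred_root]
      · simp [Deriv.Vert, ctxWire_none, pairWire_right, liftRel_root]
  · refine origin_ctx hΘ hp₁ hp₂ h₁ h₂ (fun _ _ => rfl) hpol ?_ ?_ _
    · simp [Deriv.InSync, liftPred_root]
    · simp [Deriv.Vert, pairWire_some, liftRel_root]

theorem hasColors_letPair {x y : Var} (hΘ : LCtx.Split Θ Δ Γ) (hx : Γ x = none)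
    (hy : Γ y = none) {hx' : Γ.erase x = none} {hy' : Γ.erase y = none} {hxy : x ≠ y}
    {A₀ B₀ : Ty}
    {hΓ : ((Γ.extend x A).extend y B).erase = (Γ.erase.extend x A₀).extend y B₀}
    {d₁ : Deriv I Δ.erase M (.tensor A₀ B₀)}
    {d₂ : Deriv I ((Γ.extend x A).extend y B).erase N C.erase}
    (h₁ : d₁.HasColors Δ (.tensor A' B')) (h₂ : d₂.HasColors ((Γ.extend x A).extend y B) C) :
    (Deriv.letPair x y hΘ.erase hx' hy' hxy hΓ d₁ d₂).HasColors Θ C := by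
  intro l p i hpol
  obtain ⟨hp₁, hp₂⟩ := isPremise_letPair (hΘ := hΘ.erase) (hx := hx') (hy := hy') (hxy := hxy)
    (hΓ := hΓ) (d₁ := d₁) (d₂ := d₂)
  rcases l with _ | z
  · rw [hp₂.origin_root h₂ (l' := none) (p' := p) hpol]
    · simp [seqColor]
    · simp [Deriv.InSync, liftPred_root]
    · simp [Deriv.Vert, ctxWire_none, letWire_none, liftRel_root]
  · refine origin_ctx hΘ hp₁ hp₂ h₁ h₂ (fun z hz => ?_) hpol ?_ ?_ _
    · rw [LCtx.extend_of_ne _ _ fun e : z = y => hz (e ▸ hy),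
        LCtx.extend_of_ne _ _ fun e : z = x => hz (e ▸ hx)]
    · simp [Deriv.InSync, liftPred_root]
    · simp [Deriv.Vert, letWire_some, liftRel_root]

/-- Climbing stops at the conclusion positions outside the guard context, which belong to the
synchronization point. Only the colors of the guard are needed; those of the branches are
overwritten by `i`. -/
theorem hasColors_ite {c : Option I} {i : I} (hΘ : LCtx.Split Θ Δ (Γ.paint i))
    {hΘ' : LCtx.Split Θ.erase Δ.erase Γ.erase}
    {A₀ : Ty} (hA : (A.paint i).erase = A₀) {d₁ : Deriv I Δ.erase M (.atom .bit ())}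
    {d₂ : Deriv I Γ.erase N A₀} {d₃ : Deriv I Γ.erase P A₀}
    (h₁ : d₁.HasColors Δ (.atom .bit c)) :
    (Deriv.ite i hΘ' d₁ d₂ d₃).HasColors Θ (A.paint i) := by
  intro l p j hpol
  obtain ⟨hp₁, -, -⟩ := isPremise_ite (i := i) (hΘ := hΘ') (d₁ := d₁) (d₂ := d₂) (d₃ := d₃)
  rcases l with _ | y
  · subst hA
    have hpol' : A.polAt p ≠ none := by
      simpa [seqPol, LTy.paint, LTy.polAt_erase, LTy.polAt_map] using hpol
    rw [Deriv.origin_iff]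
    simp [Deriv.InSync, Deriv.Vert, ctxWire_none, liftRel_root, liftPred_root, seqColor,
      LTy.colorAt_paint i hpol', eq_comm]
  · obtain ⟨B, hB, hB'⟩ := ne_none_of_seqPol hpol
    rcases hΘ y with ⟨h, h'⟩ | ⟨h, h'⟩
    · have hΔ : Δ y ≠ none := by simp [← h', hB]
      have hΓ : Γ y = none := by simpa [LCtx.paint, LCtx.map] using h
      rw [hp₁.origin_root h₁ (l' := some y) (p' := p) hpol]
      · simp [seqColor, h']
      · simp [Deriv.InSync, liftPred_root, LCtx.erase_eq_none_iff, hΓ]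
      · simp [Deriv.Vert, ctxWire_some, liftRel_root, LCtx.erase_eq_none_iff, hΔ]
    · rw [hB] at h'
      obtain ⟨B₁, hB₁, rfl⟩ : ∃ B₁, Γ y = some B₁ ∧ B₁.paint i = B := by
        simpa [LCtx.paint, LCtx.map, LTy.paint] using h'.symm
      have hpol' : B₁.polAt p ≠ none := by simpa [LTy.paint, LTy.polAt_map] using hB'
      rw [Deriv.origin_iff]
      simp [Deriv.InSync, Deriv.Vert, ctxWire_some, liftRel_root, liftPred_root, seqColor,
        LCtx.erase_eq_none_iff, h, hB₁, hB, LTy.colorAt_paint i hpol', eq_comm (a := i)]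

/-! ### Edges of the synchronization graph -/

/-- The edges created by links between the occurrences of the atoms of a supplied type, found at
`s`, and those of an expected type, found at `t` with the opposite polarity. -/
theorem linkEdges_eq_matchEdges {Γ₀ : Ctx} {A₀ : Ty} {d : Deriv I Γ₀ M A₀}
    {R : Pos → Pos → Prop} {s t : Path → Pos} (hR : ∀ σ τ, R σ τ ↔ ∃ p, σ = s p ∧ τ = t p)
    (e₁ : ∀ p i, A.polAt p ≠ none → (d.Origin i (s p) ↔ A'.colorAt p = some i))
    (e₂ : ∀ p i, A.polAt p ≠ none → (d.Origin i (t p) ↔ A.colorAt p = some i))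
    (p₁ : ∀ p, d.pol (s p) = A.polAt p) (p₂ : ∀ p, d.pol (t p) = (A.polAt p).map Pol.flip) :
    d.linkEdges R = matchEdges A A' := by
  -- The links are replaced by the explicit family of pairs indexed by paths, so that each edge is
  -- examined at one occurrence.
  obtain rfl : R = fun σ τ => ∃ p, σ = s p ∧ τ = t p := funext₂ fun σ τ => propext (hR σ τ)
  have p₂' : ∀ p, d.pol (t p) = some .pos ↔ A.polAt p = some .neg := fun p => by
    rw [p₂, Pol.map_flip_eq]
    rfl
  ext e
  constructor
  · rintro ⟨_, _, ⟨p, rfl, rfl⟩ | ⟨p, rfl, rfl⟩, hpos, h⟩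
    · rw [p₁] at hpos
      rw [e₁ p _ (by simp [hpos]), e₂ p _ (by simp [hpos])] at h
      exact ⟨p, .inl ⟨hpos, h⟩⟩
    · rw [p₂'] at hpos
      rw [e₁ p _ (by simp [hpos]), e₂ p _ (by simp [hpos])] at h
      exact ⟨p, .inr ⟨hpos, h⟩⟩
  · rintro ⟨p, ⟨hpos, h⟩ | ⟨hpos, h⟩⟩
    · refine ⟨_, _, .inl ⟨p, rfl, rfl⟩, (p₁ p).trans hpos, ?_⟩
      rwa [e₁ p _ (by simp [hpos]), e₂ p _ (by simp [hpos])]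
    · refine ⟨_, _, .inr ⟨p, rfl, rfl⟩, (p₂' p).2 hpos, ?_⟩
      rwa [e₁ p _ (by simp [hpos]), e₂ p _ (by simp [hpos])]

theorem linkEdges_appCut (hΘ : LCtx.Split Θ Δ Γ)
    {d₁ : Deriv I Δ.erase M (.lolli A.erase B.erase)} {d₂ : Deriv I Γ.erase N A.erase}
    (h₁ : d₁.HasColors Δ (.lolli A B)) (h₂ : d₂.HasColors Γ A') :
    (Deriv.app hΘ.erase d₁ d₂).linkEdges AppCut = matchEdges A A' := by
  obtain ⟨hp₁, hp₂⟩ := isPremise_app (hΘ := hΘ.erase) (d₁ := d₁) (d₂ := d₂)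
  -- `AppCut` runs from the expected type to the supplied one, opposite to the orientation wanted
  -- below.
  rw [← Deriv.linkEdges_swap]
  refine linkEdges_eq_matchEdges (s := fun p => ⟨[1], none, p⟩)
    (t := fun p => ⟨[0], none, .left :: p⟩) (fun σ τ => ⟨?_, ?_⟩) (fun p i hp => ?_)
    (fun p i hp => ?_) (fun p => ?_) (fun p => ?_)
  · rintro ⟨p⟩
    exact ⟨p, rfl, rfl⟩
  · rintro ⟨p, rfl, rfl⟩
    exact ⟨p⟩
  · exact (hp₂.origin i ⟨[], none, p⟩).trans (h₂ _ _ _ (by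
      simpa [seqPol, LTy.polAt_erase] using hp))
  · exact (hp₁.origin i ⟨[], none, .left :: p⟩).trans (h₁ _ _ _ (by
      simpa [seqPol, LTy.polAt, LTy.polAt_erase] using hp))
  · simp [Deriv.pol, Deriv.polAt, seqPol, LTy.polAt_erase]
  · simp [Deriv.pol, Deriv.polAt, seqPol, LTy.polAt, LTy.polAt_erase]

theorem matchEdges_tensor :
    matchEdges (.tensor A B) (.tensor A' B') = matchEdges A A' ∪ matchEdges B B' := by
  ext e
  constructor
  · rintro ⟨_ | ⟨_ | _, p⟩, h⟩
    · simp [LTy.polAt] at h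
    · exact .inl ⟨p, h⟩
    · exact .inr ⟨p, h⟩
  · rintro (⟨p, h⟩ | ⟨p, h⟩)
    · exact ⟨.left :: p, h⟩
    · exact ⟨.right :: p, h⟩

/-- The pair `M` supplies the types `A'` and `B'`; the declarations of `x` and `y` expect `A` and
`B`, with polarity reversed by the context. The two components are treated separately. -/
theorem linkEdges_letPairCut {x y : Var} (hΘ : LCtx.Split Θ Δ Γ) {hx' : Γ.erase x = none}
    {hy' : Γ.erase y = none} {hxy : x ≠ y} (hA : A.erase = A'.erase) (hB : B.erase = B'.erase)
    {hΓ : ((Γ.extend x A).extend y B).erase = (Γ.erase.extend x A'.erase).extend y B'.erase}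
    {d₁ : Deriv I Δ.erase M (.tensor A'.erase B'.erase)}
    {d₂ : Deriv I ((Γ.extend x A).extend y B).erase N C.erase}
    (h₁ : d₁.HasColors Δ (.tensor A' B')) (h₂ : d₂.HasColors ((Γ.extend x A).extend y B) C) :
    (Deriv.letPair x y hΘ.erase hx' hy' hxy hΓ d₁ d₂).linkEdges (LetPairCut x y) =
      matchEdges (.tensor A B) (.tensor A' B') := by
  obtain ⟨hp₁, hp₂⟩ := isPremise_letPair (hΘ := hΘ.erase) (hx := hx') (hy := hy') (hxy := hxy)
    (hΓ := hΓ) (d₁ := d₁) (d₂ := d₂)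
  have hcut : LetPairCut x y = fun σ τ =>
      (∃ p, σ = ⟨[0], none, .left :: p⟩ ∧ τ = ⟨[1], some x, p⟩) ∨
      (∃ p, σ = ⟨[0], none, .right :: p⟩ ∧ τ = ⟨[1], some y, p⟩) := by
    ext σ τ
    constructor
    · rintro (p | p)
      · exact .inl ⟨p, rfl, rfl⟩
      · exact .inr ⟨p, rfl, rfl⟩
    · rintro (⟨p, rfl, rfl⟩ | ⟨p, rfl, rfl⟩)
      · exact .fst p
      · exact .snd p
  have hyB : ((Γ.extend x A).extend y B) y = some B := LCtx.extend_self _ _ _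
  have hxA : ((Γ.extend x A).extend y B) x = some A := by
    rw [LCtx.extend_of_ne _ _ hxy, LCtx.extend_self]
  have hyB' : ((Γ.extend x A).extend y B).erase y = some B.erase := by
    rw [LCtx.erase, LCtx.map, hyB]
    rfl
  have hxA' : ((Γ.extend x A).extend y B).erase x = some A.erase := by
    rw [LCtx.erase, LCtx.map, hxA]
    rfl
  rw [hcut, Deriv.linkEdges_or, matchEdges_tensor]
  congr 1
  · refine linkEdges_eq_matchEdges (fun _ _ => Iff.rfl) (fun p i hp => ?_) (fun p i hp => ?_)
      (fun p => ?_) (fun p => ?_)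
    · exact (hp₁.origin i ⟨[], none, .left :: p⟩).trans (h₁ _ _ _ (by
        simpa [seqPol, LTy.polAt, ← hA, LTy.polAt_erase] using hp))
    · refine (hp₂.origin i ⟨[], some x, p⟩).trans ((h₂ _ _ _ ?_).trans (by simp [seqColor, hxA]))
      simpa [seqPol, hxA', LTy.polAt_erase] using hp
    · simp [Deriv.pol, Deriv.polAt, seqPol, LTy.polAt, ← hA, LTy.polAt_erase]
    · simp [Deriv.pol, Deriv.polAt, seqPol, hxA', LTy.polAt_erase]
  · refine linkEdges_eq_matchEdges (fun _ _ => Iff.rfl) (fun p i hp => ?_) (fun p i hp => ?_)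
      (fun p => ?_) (fun p => ?_)
    · exact (hp₁.origin i ⟨[], none, .right :: p⟩).trans (h₁ _ _ _ (by
        simpa [seqPol, LTy.polAt, ← hB, LTy.polAt_erase] using hp))
    · refine (hp₂.origin i ⟨[], some y, p⟩).trans ((h₂ _ _ _ ?_).trans (by simp [seqColor, hyB]))
      simpa [seqPol, hyB', LTy.polAt_erase] using hp
    · simp [Deriv.pol, Deriv.polAt, seqPol, LTy.polAt, ← hB, LTy.polAt_erase]
    · simp [Deriv.pol, Deriv.polAt, seqPol, hyB', LTy.polAt_erase]

/-- A derivation whose only links are those of its two premises and those in `R`. -/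
theorem syncGraph_edges_of_cut {Γ₀ Γ₁ Γ₂ : Ctx} {A₀ A₁ A₂ : Ty} {d : Deriv I Γ₀ M A₀}
    {d₁ : Deriv I Γ₁ N A₁} {d₂ : Deriv I Γ₂ P A₂} (hp₁ : IsPremise d 0 d₁)
    (hp₂ : IsPremise d 1 d₂) {R : Pos → Pos → Prop}
    (h : d.Cut = fun σ τ => R σ τ ∨ (liftRel 0 d₁.Cut σ τ ∨ liftRel 1 d₂.Cut σ τ)) :
    d.syncGraph.edges = d.linkEdges R ∪ (d₁.syncGraph.edges ∪ d₂.syncGraph.edges) := by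
  rw [d.syncGraph_edges, h, Deriv.linkEdges_or, Deriv.linkEdges_or, hp₁.linkEdges, hp₂.linkEdges]

/-! ### The synchronization graph, rule by rule. -/

theorem syncGraph_ax (x : Var) (ι : LTy I) {Γ₀ : Ctx} {A₀ : Ty} (hA : ι.erase = A₀)
    (hΓ : Γ₀ = LCtx.single x A₀) :
    (Deriv.ax x ι hA hΓ : Deriv I Γ₀ (.var x) A₀).syncGraph =
      SGraph.discrete {i | i ∈ ι.labels} :=
  SGraph.ext rfl ((Deriv.syncGraph_edges _).trans (Deriv.linkEdges_false _))

theorem syncGraph_op (i : I) (c : Op) {Γ₀ : Ctx} {A₀ : Ty} (hA : A₀ = c.type)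
    (hΓ : Γ₀ = LCtx.empty) :
    (Deriv.op i c hA hΓ : Deriv I Γ₀ (.op c) A₀).syncGraph = SGraph.discrete {i} :=
  SGraph.ext (Set.ext fun _ => List.mem_singleton)
    ((Deriv.syncGraph_edges _).trans (Deriv.linkEdges_false _))

theorem syncGraph_star {Γ₀ : Ctx} (hΓ : Γ₀ = LCtx.empty) :
    (Deriv.star hΓ : Deriv I Γ₀ .star _).syncGraph = SGraph.empty :=
  SGraph.ext (Set.ext fun _ => iff_of_false List.not_mem_nil id)
    ((Deriv.syncGraph_edges _).trans (Deriv.linkEdges_false _))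

theorem syncGraph_lam {Γ₀ Γ₁ : Ctx} {A₀ B₀ : Ty} {x : Var} {hx : Γ₀ x = none}
    {hΓ : Γ₁ = Γ₀.extend x A₀} {d : Deriv I Γ₁ M B₀} :
    (Deriv.lam x hx hΓ d).syncGraph = d.syncGraph :=
  SGraph.ext rfl ((Deriv.syncGraph_edges _).trans isPremise_lam.linkEdges)

theorem syncGraph_app (hΘ : LCtx.Split Θ Δ Γ)
    {d₁ : Deriv I Δ.erase M (.lolli A.erase B.erase)} {d₂ : Deriv I Γ.erase N A.erase}
    (h₁ : d₁.HasColors Δ (.lolli A B)) (h₂ : d₂.HasColors Γ A') :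
    (Deriv.app hΘ.erase d₁ d₂).syncGraph =
      (d₁.syncGraph.union d₂.syncGraph).addEdges (matchEdges A A') := by
  refine SGraph.ext (Set.ext fun i => List.mem_append) ?_
  refine (syncGraph_edges_of_cut isPremise_app.1 isPremise_app.2 rfl).trans ?_
  rw [linkEdges_appCut hΘ h₁ h₂, Set.union_comm]
  rfl

/-- The unit consumed by the rule is linked to nothing, which is why its color is irrelevant. -/
theorem syncGraph_letStar {Θ₀ Δ₀ Γ₀ : Ctx} {A₀ : Ty} {hΘ : LCtx.Split Θ₀ Δ₀ Γ₀}
    {d₁ : Deriv I Δ₀ M (.atom .one ())} {d₂ : Deriv I Γ₀ N A₀} :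
    (Deriv.letStar hΘ d₁ d₂).syncGraph = d₁.syncGraph.union d₂.syncGraph := by
  refine SGraph.ext (Set.ext fun i => List.mem_append) ?_
  refine (syncGraph_edges_of_cut (R := fun _ _ => False) isPremise_letStar.1 isPremise_letStar.2
    (by simp [Deriv.Cut])).trans ?_
  rw [Deriv.linkEdges_false, Set.empty_union]
  rfl

theorem syncGraph_pair {Θ₀ Δ₀ Γ₀ : Ctx} {A₀ B₀ : Ty} {hΘ : LCtx.Split Θ₀ Δ₀ Γ₀}
    {d₁ : Deriv I Δ₀ M A₀} {d₂ : Deriv I Γ₀ N B₀} :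
    (Deriv.pair hΘ d₁ d₂).syncGraph = d₁.syncGraph.union d₂.syncGraph := by
  refine SGraph.ext (Set.ext fun i => List.mem_append) ?_
  refine (syncGraph_edges_of_cut (R := fun _ _ => False) isPremise_pair.1 isPremise_pair.2
    (by simp [Deriv.Cut])).trans ?_
  rw [Deriv.linkEdges_false, Set.empty_union]
  rfl

theorem syncGraph_letPair {x y : Var} (hΘ : LCtx.Split Θ Δ Γ) {hx' : Γ.erase x = none}
    {hy' : Γ.erase y = none} {hxy : x ≠ y} (hA : A.erase = A'.erase) (hB : B.erase = B'.erase)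
    {hΓ : ((Γ.extend x A).extend y B).erase = (Γ.erase.extend x A'.erase).extend y B'.erase}
    {d₁ : Deriv I Δ.erase M (.tensor A'.erase B'.erase)}
    {d₂ : Deriv I ((Γ.extend x A).extend y B).erase N C.erase}
    (h₁ : d₁.HasColors Δ (.tensor A' B')) (h₂ : d₂.HasColors ((Γ.extend x A).extend y B) C) :
    (Deriv.letPair x y hΘ.erase hx' hy' hxy hΓ d₁ d₂).syncGraph =
      (d₁.syncGraph.union d₂.syncGraph).addEdges
        (matchEdges (.tensor A B) (.tensor A' B')) := by
  refine SGraph.ext (Set.ext fun i => List.mem_append) ?_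
  refine (syncGraph_edges_of_cut isPremise_letPair.1 isPremise_letPair.2 rfl).trans ?_
  rw [linkEdges_letPairCut hΘ hA hB h₁ h₂, Set.union_comm]
  rfl

/-- The conditional links no premises, so it adds only its own node; the guard bit and the
conclusions of the branches have no wire below them. -/
theorem syncGraph_ite {Θ₀ Δ₀ Γ₀ : Ctx} {A₀ : Ty} {i : I} {hΘ : LCtx.Split Θ₀ Δ₀ Γ₀}
    {d₁ : Deriv I Δ₀ M (.atom .bit ())} {d₂ : Deriv I Γ₀ N A₀} {d₃ : Deriv I Γ₀ P A₀} :
    (Deriv.ite i hΘ d₁ d₂ d₃).syncGraph =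
      ((d₁.syncGraph.union d₂.syncGraph).union d₃.syncGraph).union (SGraph.discrete {i}) := by
  refine SGraph.ext (Set.ext fun j => ?_) ?_
  · simp [Deriv.syncGraph, Deriv.indices, SGraph.union, SGraph.discrete, or_assoc]
  · rw [Deriv.syncGraph_edges]
    refine (Deriv.linkEdges_or _ (liftRel 0 _) (fun σ τ => liftRel 1 _ σ τ ∨ liftRel 2 _ σ τ)).trans
      ?_
    rw [Deriv.linkEdges_or, isPremise_ite.1.linkEdges, isPremise_ite.2.1.linkEdges,
      isPremise_ite.2.2.linkEdges]
    simp [SGraph.union, SGraph.discrete, Set.union_assoc]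

end Rules

/-! ### Transport along equalities of contexts and types. -/

section Recast

variable {I : Type u} {Γ₀ Γ₁ : Ctx} {M : Tm} {A₀ A₁ : Ty}

theorem Deriv.recast_hasColors {hΓ : Γ₀ = Γ₁} {hA : A₀ = A₁} {d : Deriv I Γ₀ M A₀} {Γ : CCtx I}
    {A : CTy I} (h : d.HasColors Γ A) : (d.recast hΓ hA).HasColors Γ A := by
  subst hΓ hA
  exact h

theorem Deriv.recast_syncGraph {hΓ : Γ₀ = Γ₁} {hA : A₀ = A₁} {d : Deriv I Γ₀ M A₀} :
    (d.recast hΓ hA).syncGraph = d.syncGraph := by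
  subst hΓ hA
  rfl

theorem Deriv.recast_heq {hΓ : Γ₀ = Γ₁} {hA : A₀ = A₁} {d : Deriv I Γ₀ M A₀} :
    HEq (d.recast hΓ hA) d := by
  subst hΓ hA
  rfl

end Recast

/-- The colors of the conclusion of a colored derivation, and its graph, are those of the
underlying indexed derivation. -/
theorem CDeriv.hasColors_and_graph_eq {I : Type u} {Γ : CCtx I} {G : SGraph I} {M : Tm}
    {A : CTy I} (D : CDeriv I Γ G M A) :
    D.erase.HasColors Γ A ∧ G = D.erase.syncGraph := by
  induction D with
  | ax x ι hA hΓ =>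
    subst hA hΓ
    exact ⟨hasColors_ax _ _ _ _, (syncGraph_ax _ _ _ _).symm⟩
  | lam x hx hΓ D ih =>
    subst hΓ
    exact ⟨hasColors_lam ih.1, ih.2.trans syncGraph_lam.symm⟩
  | app hΘ hA D₁ D₂ ih₁ ih₂ =>
    -- The argument keeps its own colors `A'`; only its erased type is identified with the one
    -- expected by the function.
    have h₂ := Deriv.recast_hasColors (hΓ := rfl) (hA := hA.symm) ih₂.1
    exact ⟨hasColors_app hΘ ih₁.1 h₂, (congrArg₂ (fun G H => (SGraph.union G H).addEdges _) ih₁.2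
      (ih₂.2.trans Deriv.recast_syncGraph.symm)).trans (syncGraph_app hΘ ih₁.1 h₂).symm⟩
  | star hΓ =>
    subst hΓ
    exact ⟨hasColors_star _, (syncGraph_star _).symm⟩
  | letStar hΘ D₁ D₂ ih₁ ih₂ =>
    exact ⟨hasColors_letStar hΘ ih₁.1 ih₂.1,
      (congrArg₂ SGraph.union ih₁.2 ih₂.2).trans syncGraph_letStar.symm⟩
  | pair hΘ D₁ D₂ ih₁ ih₂ =>
    exact ⟨hasColors_pair hΘ ih₁.1 ih₂.1,
      (congrArg₂ SGraph.union ih₁.2 ih₂.2).trans syncGraph_pair.symm⟩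
  | letPair x y hΘ hx hy hxy hΓ hA hB D₁ D₂ ih₁ ih₂ =>
    subst hΓ
    exact ⟨hasColors_letPair hΘ hx hy ih₁.1 ih₂.1,
      (congrArg₂ (fun G H => (SGraph.union G H).addEdges _) ih₁.2 ih₂.2).trans
        (syncGraph_letPair hΘ hA hB ih₁.1 ih₂.1).symm⟩
  | ite i hΘ hΓi hAi hΓ hA D₁ D₂ D₃ ih₁ ih₂ ih₃ =>
    subst hΓi hAi
    exact ⟨hasColors_ite hΘ rfl ih₁.1, (congrArg (SGraph.union · _) (congrArg₂ SGraph.union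
      (congrArg₂ SGraph.union ih₁.2 (ih₂.2.trans Deriv.recast_syncGraph.symm))
      (ih₃.2.trans Deriv.recast_syncGraph.symm))).trans syncGraph_ite.symm⟩
  | op i c hA hΓ =>
    subst hA hΓ
    exact ⟨hasColors_op _ _ _ _, (syncGraph_op _ _ _ _).symm⟩

/-! ### Coloring an indexed derivation -/

theorem LTy.erase_eq_atom {L : Type u} {A : LTy L} {a : Atom} (h : A.erase = .atom a ()) :
    ∃ l, A = .atom a l := by
  cases A with
  | atom b l => cases h; exact ⟨l, rfl⟩
  | lolli A B => cases h
  | tensor A B => cases h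

theorem LTy.erase_eq_lolli {L : Type u} {A : LTy L} {A₁ A₂ : Ty} (h : A.erase = .lolli A₁ A₂) :
    ∃ B₁ B₂, A = .lolli B₁ B₂ ∧ B₁.erase = A₁ ∧ B₂.erase = A₂ := by
  cases A with
  | atom b l => cases h
  | lolli A B => cases h; exact ⟨A, B, rfl, rfl, rfl⟩
  | tensor A B => cases h

theorem LTy.erase_eq_tensor {L : Type u} {A : LTy L} {A₁ A₂ : Ty}
    (h : A.erase = .tensor A₁ A₂) :
    ∃ B₁ B₂, A = .tensor B₁ B₂ ∧ B₁.erase = A₁ ∧ B₂.erase = A₂ := by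
  cases A with
  | atom b l => cases h
  | lolli A B => cases h
  | tensor A B => cases h; exact ⟨A, B, rfl, rfl, rfl⟩

/-- Recovers the colored type that a premise gives to a bound variable, together with the rest of
its context. -/
theorem LCtx.exists_of_erase_eq_extend {L : Type u} {Γ : LCtx L} {Γ₀ : Ctx} {x : Var} {A₀ : Ty}
    (hx : Γ₀ x = none) (h : Γ.erase = Γ₀.extend x A₀) :
    ∃ Δ A, Γ = LCtx.extend Δ x A ∧ Δ.erase = Γ₀ ∧ A.erase = A₀ ∧ Δ x = none := by
  have hA : Γ.erase x = some A₀ := by rw [h, LCtx.extend_self]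
  obtain ⟨A, hΓ, rfl⟩ : ∃ A, Γ x = some A ∧ A.erase = A₀ := by
    simpa [LCtx.erase, LCtx.map, LTy.erase] using hA
  refine ⟨Function.update Γ x none, A, ?_, ?_, rfl, by simp⟩
  · simp [LCtx.extend, ← hΓ]
  · funext y
    by_cases hy : y = x
    · subst hy
      simp [LCtx.erase, LCtx.map, hx]
    · have := congrFun h y
      rw [LCtx.extend_of_ne _ _ hy] at this
      simpa [LCtx.erase, LCtx.map, hy] using this

theorem LCtx.Split.exists_union {L : Type u} {Θ₀ : Ctx} {Δ Γ : LCtx L}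
    (h : LCtx.Split Θ₀ Δ.erase Γ.erase) : ∃ Θ, Θ.erase = Θ₀ ∧ LCtx.Split Θ Δ Γ := by
  -- The order in `or` is immaterial: the erasures, and hence the contexts, declare no common
  -- variable.
  refine ⟨fun x => (Δ x).or (Γ x), ?_, fun x => ?_⟩
  · funext x
    rcases h x with ⟨h₁, h₂⟩ | ⟨h₁, h₂⟩
    · rw [LCtx.erase_eq_none_iff] at h₁
      simp [h₂, LCtx.erase, LCtx.map, h₁]
    · rw [LCtx.erase_eq_none_iff] at h₁
      simp [h₂, LCtx.erase, LCtx.map, h₁]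
  · rcases h x with ⟨h₁, -⟩ | ⟨h₁, -⟩ <;> rw [LCtx.erase_eq_none_iff] at h₁
    · exact .inl ⟨h₁, by simp [h₁]⟩
    · exact .inr ⟨h₁, by simp [h₁]⟩

/-- Erasing a painted type gives the erasure of the original only up to a propositional equality, so
derivations of the branches are compared heterogeneously. -/
theorem Deriv.ite_heq {I : Type u} {Θ Δ Γ Γ' : Ctx} {M N P : Tm} {A A' : Ty} {i : I}
    {hΘ : LCtx.Split Θ Δ Γ} {hΘ' : LCtx.Split Θ Δ Γ'} {d₁ : Deriv I Δ M (.atom .bit ())}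
    {d₂ : Deriv I Γ N A} {d₃ : Deriv I Γ P A} {d₂' : Deriv I Γ' N A'} {d₃' : Deriv I Γ' P A'}
    (hΓ : Γ = Γ') (hA : A = A') (h₂ : HEq d₂ d₂') (h₃ : HEq d₃ d₃') :
    HEq (Deriv.ite i hΘ d₁ d₂ d₃) (Deriv.ite i hΘ' d₁ d₂' d₃') := by
  subst hΓ hA
  cases h₂
  cases h₃
  rfl

/-- No choice of colors obstructs the induction: applications, pair eliminations and branches
require equal erasures only, and guards may have any color. The heterogeneous equality accounts for
contexts and types that are equal but not syntactically so. -/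
theorem Deriv.exists_colored {I : Type u} {Γ : Ctx} {M : Tm} {A : Ty} (d : Deriv I Γ M A) :
    ∃ (Γ' : CCtx I) (G : SGraph I) (A' : CTy I) (D : CDeriv I Γ' G M A'),
      Γ'.erase = Γ ∧ A'.erase = A ∧ HEq D.erase d := by
  induction d with
  | ax x ι hA hΓ =>
    subst hA hΓ
    have hΓ' : (LCtx.single x (ι.map some)).erase = LCtx.single x ι.erase := by
      rw [LCtx.erase_single, LTy.erase_map]
    refine ⟨_, _, _, .ax x ι rfl rfl, hΓ', LTy.erase_map _ _, ?_⟩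
    simp only [CDeriv.erase]
    congr 1 <;> first | exact hΓ' | exact LTy.erase_map _ _ | exact proof_irrel_heq _ _
  | lam x hx hΓ d ih =>
    obtain ⟨Γ', G, B, D, hΓ', rfl, h⟩ := ih
    subst hΓ
    obtain ⟨Δ, A, rfl, rfl, rfl, hΔ⟩ := LCtx.exists_of_erase_eq_extend hx hΓ'
    refine ⟨Δ, G, .lolli A B, .lam x hΔ rfl D, rfl, rfl, ?_⟩
    simp only [CDeriv.erase]
    congr 1
    exact proof_irrel_heq _ _
  | app hΘ d₁ d₂ ih₁ ih₂ =>
    obtain ⟨Δ, G₁, F, D₁, rfl, hF, h₁⟩ := ih₁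
    obtain ⟨Γ, G₂, A', D₂, rfl, rfl, h₂⟩ := ih₂
    obtain ⟨A, B, rfl, hA, rfl⟩ := LTy.erase_eq_lolli hF
    obtain ⟨Θ, rfl, hΘ'⟩ := hΘ.exists_union
    refine ⟨Θ, _, B, .app hΘ' hA D₁ D₂, rfl, rfl, ?_⟩
    simp only [CDeriv.erase]
    congr 1
    exact Deriv.recast_heq.trans h₂
  | star hΓ =>
    subst hΓ
    exact ⟨LCtx.empty, _, _, .star rfl, rfl, rfl, HEq.rfl⟩
  | letStar hΘ d₁ d₂ ih₁ ih₂ =>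
    obtain ⟨Δ, G₁, F, D₁, rfl, hF, h₁⟩ := ih₁
    obtain ⟨Γ, G₂, A, D₂, rfl, rfl, h₂⟩ := ih₂
    obtain ⟨c, rfl⟩ := LTy.erase_eq_atom hF
    obtain ⟨Θ, rfl, hΘ'⟩ := hΘ.exists_union
    cases h₁
    cases h₂
    exact ⟨Θ, _, A, .letStar hΘ' D₁ D₂, rfl, rfl, HEq.rfl⟩
  | pair hΘ d₁ d₂ ih₁ ih₂ =>
    obtain ⟨Δ, G₁, A, D₁, rfl, rfl, h₁⟩ := ih₁
    obtain ⟨Γ, G₂, B, D₂, rfl, rfl, h₂⟩ := ih₂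
    obtain ⟨Θ, rfl, hΘ'⟩ := hΘ.exists_union
    cases h₁
    cases h₂
    exact ⟨Θ, _, .tensor A B, .pair hΘ' D₁ D₂, rfl, rfl, HEq.rfl⟩
  | letPair x y hΘ hx hy hxy hΓ d₁ d₂ ih₁ ih₂ =>
    obtain ⟨Δ, G₁, F, D₁, rfl, hF, h₁⟩ := ih₁
    obtain ⟨Γ', G₂, C, D₂, rfl, rfl, h₂⟩ := ih₂
    obtain ⟨A', B', rfl, rfl, rfl⟩ := LTy.erase_eq_tensor hF
    -- The outer declaration `y` is removed before `x`; its freshness below `x` uses that the two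
    -- variables differ.
    obtain ⟨Γ₁, B, rfl, hΓ₁, hB, hy₁⟩ := LCtx.exists_of_erase_eq_extend
      (by rw [LCtx.extend_of_ne _ _ hxy.symm, hy]) hΓ
    obtain ⟨Γ, A, rfl, rfl, hA, hx₁⟩ := LCtx.exists_of_erase_eq_extend hx hΓ₁
    rw [LCtx.extend_of_ne _ _ hxy.symm] at hy₁
    obtain ⟨Θ, rfl, hΘ'⟩ := hΘ.exists_union
    cases h₁
    cases h₂
    exact ⟨Θ, _, C, .letPair x y hΘ' hx₁ hy₁ hxy rfl hA hB D₁ D₂, rfl, rfl, HEq.rfl⟩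
  | ite i hΘ d₁ d₂ d₃ ih₁ ih₂ ih₃ =>
    obtain ⟨Δ, G₁, F, D₁, rfl, hF, h₁⟩ := ih₁
    obtain ⟨Γ, G₂, A, D₂, rfl, rfl, h₂⟩ := ih₂
    obtain ⟨Γ', G₃, A', D₃, hΓ, hA, h₃⟩ := ih₃
    obtain ⟨c, rfl⟩ := LTy.erase_eq_atom hF
    -- The painted context is the one joined to that of the guard; painting does not alter the
    -- erasure, so the given splitting still applies.
    obtain ⟨Θ, rfl, hΘ'⟩ := LCtx.Split.exists_union (Δ := Δ) (Γ := Γ.paint i)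
      ((LCtx.erase_paint i Γ).symm ▸ hΘ)
    cases h₁
    refine ⟨Θ, _, A.paint i, .ite i hΘ' rfl rfl hΓ.symm hA.symm D₁ D₂ D₃, rfl,
      LTy.erase_map _ _, ?_⟩
    exact Deriv.ite_heq rfl (LTy.erase_map _ _) (Deriv.recast_heq.trans h₂)
      (Deriv.recast_heq.trans h₃)
  | op i c hA hΓ =>
    subst hA hΓ
    have hA' : (c.type.paint i).erase = c.type := by
      rw [LTy.paint, LTy.erase_map, LTy.erase_plain]
    refine ⟨LCtx.empty, _, _, .op i c rfl rfl, rfl, hA', ?_⟩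
    simp only [CDeriv.erase]
    congr 1
    exact proof_irrel_heq _ _

end QLam

/-! ### Exactness of the colored system and the acyclicity criterion. -/

theorem mainTheorem5 {I : Type*} :
    (∀ (Γ : QLam.CCtx I) (G : QLam.SGraph I) (M : QLam.Tm) (A : QLam.CTy I)
      (D : QLam.CDeriv I Γ G M A), G = D.erase.syncGraph) ∧
    (∀ (Γ : QLam.Ctx) (M : QLam.Tm) (A : QLam.Ty) (d : QLam.Deriv I Γ M A),
      ∃ (Γ' : QLam.CCtx I) (G : QLam.SGraph I) (A' : QLam.CTy I) (D : QLam.CDeriv I Γ' G M A'),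
        Γ'.erase = Γ ∧ A'.erase = A ∧ HEq D.erase d) ∧
    (∀ (Γ : QLam.Ctx) (M : QLam.Tm) (A : QLam.Ty),
      (∃ (Γ' : QLam.CCtx I) (G : QLam.SGraph I) (A' : QLam.CTy I) (D : QLam.CDeriv I Γ' G M A'),
        Γ'.erase = Γ ∧ A'.erase = A ∧ D.erase.WellIndexed ∧ G.Acyclic) ↔
      ∃ d : QLam.Deriv I Γ M A, d.WellIndexed ∧ d.syncGraph.Acyclic) := by
  refine ⟨fun _ _ _ _ D => D.hasColors_and_graph_eq.2, fun _ _ _ d => d.exists_colored,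
    fun Γ M A => ⟨?_, ?_⟩⟩
  · rintro ⟨Γ', G, A', D, rfl, rfl, hw, ha⟩
    exact ⟨D.erase, hw, D.hasColors_and_graph_eq.2 ▸ ha⟩
  · rintro ⟨d, hw, ha⟩
    obtain ⟨Γ', G, A', D, rfl, rfl, h⟩ := d.exists_colored
    -- With contexts and types identified, the heterogeneous equality is an ordinary one, and
    -- well-indexing and acyclicity pass to the colored derivation.
    cases h
    exact ⟨Γ', G, A', D, rfl, rfl, hw, D.hasColors_and_graph_eq.2.symm ▸ ha⟩
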